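/- Let $A,\alpha\in\mathbb{R}$. Let $\Gamma$ be the chain graph made of infinitely many rings of circumference $2\pi$, neighbouring rings touching at the vertices $j\pi$, $j\in\mathbb{Z}$. The upper and the lower semicircle of the $j$-th ring are each parametrized by $I_j=(j\pi,(j+1)\pi)$, so that $L^2(\Gamma)=L^2(\mathbb{R})\oplus L^2(\mathbb{R})$; write $\psi_j$ and $\varphi_j$ for the components of a function on the upper and the lower semicircle of the $j$-th ring. Let $\mathcal{D}=\frac{d}{dx}+iA$ on the upper and $\mathcal{D}=\frac{d}{dx}-iA$ on the lower semicircles. For a real sequence $\boldsymbol\beta=(\beta_j)_{j\in\mathbb{Z}}$ let $-\Delta_{\boldsymbol\beta}$ be the operator in $L^2(\Gamma)$ that acts as $-\mathcal{D}^2$ on each edge, on the domain of all functions in $L^2(\Gamma)$ that are in $H^2$ on each edge, are mapped into $L^2(\Gamma)$ by $-\mathcal{D}^2$, and satisfy for all $j\in\mathbb{Z}$ $$\psi_j(j\pi)=\varphi_j(j\pi)=\psi_{j-1}(j\pi)=\varphi_{j-1}(j\pi),$$ $$\mathcal{D}\psi_j(j\pi)+\mathcal{D}\varphi_j(j\pi)-\mathcal{D}\psi_{j-1}(j\pi)-\mathcal{D}\varphi_{j-1}(j\pi)=\beta_j\,\psi_j(j\pi).$$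 Write $-\Delta_\alpha$ for this operator with $\beta_j=\alpha$ for all $j$. Let $m\ge 1$ be an integer, let $\gamma_1,\dots,\gamma_m\in\mathbb{R}$, and write $-\Delta_{\alpha+\gamma}$ for this operator with $\beta_j=\alpha+\gamma_j$ for $1\le j\le m$ and $\beta_j=\alpha$ for all other $j$. Theorem. The essential spectrum of $-\Delta_{\alpha+\gamma}$ coincides with the essential spectrum of $-\Delta_\alpha$. If, moreover, $\gamma_1=\dots=\gamma_m<0$, then $-\Delta_{\alpha+\gamma}$ has at least one eigenvalue below the first spectral band of $-\Delta_\alpha$; that is, the spectrum of $-\Delta_\alpha$ has a smallest element $b$ (the lower edge of its first band), and $-\Delta_{\alpha+\gamma}$ has a real eigenvalue $E<b$. -/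

import Mathlib

open MeasureTheory

namespace RingChain

noncomputable section

/-! ### Spectral notions for an unbounded operator -/

section Spectral

variable {H : Type*} [NormedAddCommGroup H] [InnerProductSpace ℂ H]

/-- `T - z`, as a linear map from the domain of `T` to the Hilbert space. -/
def shift (T : H →ₗ.[ℂ] H) (z : ℂ) : T.domain →ₗ[ℂ] H :=
  T.toFun - z • T.domain.subtype

/-- `z` is in the resolvent set: `T - z` has an everywhere defined bounded inverse. -/
def IsResolventPoint (T : H →ₗ.[ℂ] H) (z : ℂ) : Prop :=
  ∃ R : H →L[ℂ] H,
    (∀ x : T.domain, R (shift T z x) = (x : H)) ∧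
    ∀ y : H, ∃ h : R y ∈ T.domain, shift T z ⟨R y, h⟩ = y

/-- The spectrum of an unbounded operator. -/
def spectrum (T : H →ₗ.[ℂ] H) : Set ℂ := {z | ¬ IsResolventPoint T z}

/-- `z` is an eigenvalue of `T`. -/
def IsEigenvalue (T : H →ₗ.[ℂ] H) (z : ℂ) : Prop :=
  ∃ x : T.domain, (x : H) ≠ 0 ∧ T x = z • (x : H)

/-- `T - z` is a Fredholm operator: finite-dimensional kernel, closed range of finite
codimension. -/
structure IsFredholmAt (T : H →ₗ.[ℂ] H) (z : ℂ) : Prop where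
  finiteDimensional_ker : FiniteDimensional ℂ (LinearMap.ker (shift T z))
  isClosed_range : IsClosed (LinearMap.range (shift T z) : Set H)
  finiteDimensional_coker : FiniteDimensional ℂ (H ⧸ LinearMap.range (shift T z))

/-- The essential spectrum: the points `z` such that `T - z` is not Fredholm. For a self-adjoint
operator this is the spectrum without the isolated eigenvalues of finite multiplicity. -/
def essSpectrum (T : H →ₗ.[ℂ] H) : Set ℂ := {z | ¬ IsFredholmAt T z}

end Spectral

/-! ### The chain of rings

Upper (`true`) and lower (`false`) semicircles of all rings are parametrized by two copies of `ℝ`;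
the `j`-th ring corresponds to the interval `(jπ, (j+1)π)` in both copies, and the vertices are
the points `jπ`. -/

/-- `L²(Γ)`. -/
abbrev L2Chain : Type := PiLp 2 (fun _ : Bool => Lp ℂ 2 (volume : Measure ℝ))

/-- The open interval `(jπ, (j+1)π)` that carries the `j`-th ring. -/
def edge (j : ℤ) : Set ℝ := Set.Ioo (j * Real.pi) ((j + 1) * Real.pi)

/-- `u` is in the Sobolev space `H²(a, b)` with first and second derivatives `v` and `w`:
`u` and `v` are absolutely continuous on `[a, b]` with derivatives `v` and `w`, respectively, and
`w` is square integrable. -/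
structure HasSobolevDerivs (a b : ℝ) (u v w : ℝ → ℂ) : Prop where
  memLp : MemLp w 2 (volume.restrict (Set.Ioo a b))
  deriv_eq : ∀ x ∈ Set.Icc a b, v x = v a + ∫ t in a..x, w t
  self_eq : ∀ x ∈ Set.Icc a b, u x = u a + ∫ t in a..x, v t

/-- The coefficient in the quasiderivative `𝒟 = d/dx ± iA`: the vector potential is `-A` on the
upper semicircles and `A` on the lower ones. -/
def coeff (A : ℝ) (s : Bool) : ℂ := if s then Complex.I * A else -(Complex.I * A)

/-- The quasiderivative `u' + c u` of a function `u` with derivative `v`. -/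
def quasiDeriv (c : ℂ) (u v : ℝ → ℂ) (x : ℝ) : ℂ := v x + c * u x

/-- `ψ` belongs to the domain of the magnetic Laplacian with `δ`-couplings of strengths `α j` at the
vertices `jπ`, and `η = -𝒟²ψ`. The functions `u s j`, `v s j`, `w s j` are the representative
of `ψ` on the edge `(s, j)` and its first two derivatives. -/
structure IsWaveFunction (A : ℝ) (α : ℤ → ℝ) (ψ η : L2Chain) (u v w : Bool → ℤ → ℝ → ℂ) :
    Prop where
  sobolev : ∀ (s : Bool) (j : ℤ), HasSobolevDerivs (j * Real.pi) ((j + 1) * Real.pi) (u s j) (v s j) (w s j)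
  ae_eq : ∀ s j, ∀ᵐ x ∂(volume.restrict (edge j)), (ψ s : ℝ → ℂ) x = u s j x
  action : ∀ s j, ∀ᵐ x ∂(volume.restrict (edge j)), (η s : ℝ → ℂ) x =
    -quasiDeriv (coeff A s) (quasiDeriv (coeff A s) (u s j) (v s j))
      (quasiDeriv (coeff A s) (v s j) (w s j)) x
  cont_lower : ∀ j : ℤ, u false j (j * Real.pi) = u true j (j * Real.pi)
  cont_left : ∀ (s : Bool) (j : ℤ), u s (j - 1) (j * Real.pi) = u true j (j * Real.pi)
  delta : ∀ j : ℤ,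
    quasiDeriv (coeff A true) (u true j) (v true j) (j * Real.pi)
      + quasiDeriv (coeff A false) (u false j) (v false j) (j * Real.pi)
      - quasiDeriv (coeff A true) (u true (j - 1)) (v true (j - 1)) (j * Real.pi)
      - quasiDeriv (coeff A false) (u false (j - 1)) (v false (j - 1)) (j * Real.pi)
      = α j * u true j (j * Real.pi)

theorem HasSobolevDerivs.intervalIntegrable {a b : ℝ} {u v w : ℝ → ℂ}
    (h : HasSobolevDerivs a b u v w) {x : ℝ} (hx : x ∈ Set.Icc a b) :
    IntervalIntegrable w volume a x ∧ IntervalIntegrable v volume a x := by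
  have hab : a ≤ b := hx.1.trans hx.2
  have hw : IntegrableOn w (Set.Icc a b) := by
    rw [integrableOn_Icc_iff_integrableOn_Ioo]
    exact h.memLp.integrable (by norm_num)
  have hc : ContinuousOn v (Set.Icc a b) :=
    (continuousOn_const.add (by
      simpa only [Set.uIcc_of_le hab] using intervalIntegral.continuousOn_primitive_interval
        (a := a) (b := b) (by rwa [Set.uIcc_of_le hab]))).congr h.deriv_eq
  have hs : Set.Icc a x ⊆ Set.Icc a b := Set.Icc_subset_Icc_right hx.2
  refine ⟨?_, ?_⟩
  · rw [intervalIntegrable_iff_integrableOn_Icc_of_le hx.1]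
    exact hw.mono_set hs
  · apply ContinuousOn.intervalIntegrable
    rw [Set.uIcc_of_le hx.1]
    exact hc.mono hs

theorem HasSobolevDerivs.add {a b : ℝ} {u v w u' v' w' : ℝ → ℂ}
    (h : HasSobolevDerivs a b u v w) (h' : HasSobolevDerivs a b u' v' w') :
    HasSobolevDerivs a b (u + u') (v + v') (w + w') where
  memLp := h.memLp.add h'.memLp
  deriv_eq x hx := by
    simp only [Pi.add_apply]
    rw [intervalIntegral.integral_add (h.intervalIntegrable hx).1 (h'.intervalIntegrable hx).1,
      h.deriv_eq x hx, h'.deriv_eq x hx]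
    ring
  self_eq x hx := by
    simp only [Pi.add_apply]
    rw [intervalIntegral.integral_add (h.intervalIntegrable hx).2 (h'.intervalIntegrable hx).2,
      h.self_eq x hx, h'.self_eq x hx]
    ring

theorem HasSobolevDerivs.smul {a b : ℝ} {u v w : ℝ → ℂ} (c : ℂ)
    (h : HasSobolevDerivs a b u v w) : HasSobolevDerivs a b (c • u) (c • v) (c • w) where
  memLp := h.memLp.const_smul c
  deriv_eq x hx := by
    simp only [Pi.smul_apply, intervalIntegral.integral_smul, h.deriv_eq x hx, smul_add]
  self_eq x hx := by
    simp only [Pi.smul_apply, intervalIntegral.integral_smul, h.self_eq x hx, smul_add]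

/-- The graph of the magnetic Laplacian. -/
def hamiltonianGraph (A : ℝ) (α : ℤ → ℝ) : Submodule ℂ (L2Chain × L2Chain) where
  carrier := {p | ∃ u v w, IsWaveFunction A α p.1 p.2 u v w}
  zero_mem' := by
    refine ⟨0, 0, 0, ⟨fun s j => ⟨MemLp.zero, by simp, by simp⟩, fun s j => ?_, fun s j => ?_,
      by simp, by simp, by simp [quasiDeriv]⟩⟩
    · exact Filter.Eventually.of_forall fun x => by simp
    · exact Filter.Eventually.of_forall fun x => by simp [quasiDeriv]
  add_mem' := by
    rintro p q ⟨u, v, w, h⟩ ⟨u', v', w', h'⟩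
    refine ⟨u + u', v + v', w + w', ⟨fun s j => (h.sobolev s j).add (h'.sobolev s j),
      fun s j => ?_, fun s j => ?_, fun j => ?_, fun s j => ?_, fun j => ?_⟩⟩
    · filter_upwards [h.ae_eq s j, h'.ae_eq s j,
        ae_restrict_of_ae (Lp.coeFn_add (p.1 s) (q.1 s))] with x h1 h2 h3
      simpa [h1, h2] using h3
    · filter_upwards [h.action s j, h'.action s j,
        ae_restrict_of_ae (Lp.coeFn_add (p.2 s) (q.2 s))] with x h1 h2 h3
      rw [Prod.snd_add, PiLp.add_apply, h3, Pi.add_apply, h1, h2]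
      simp only [quasiDeriv, Pi.add_apply]
      ring
    · simp only [Pi.add_apply, h.cont_lower, h'.cont_lower]
    · simp only [Pi.add_apply, h.cont_left, h'.cont_left]
    · have h1 := h.delta j
      have h2 := h'.delta j
      simp only [quasiDeriv, Pi.add_apply] at h1 h2 ⊢
      linear_combination h1 + h2
  smul_mem' := by
    rintro c p ⟨u, v, w, h⟩
    refine ⟨c • u, c • v, c • w, ⟨fun s j => (h.sobolev s j).smul c,
      fun s j => ?_, fun s j => ?_, fun j => ?_, fun s j => ?_, fun j => ?_⟩⟩
    · filter_upwards [h.ae_eq s j,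
        ae_restrict_of_ae (Lp.coeFn_smul c (p.1 s))] with x h1 h3
      simpa [h1] using h3
    · filter_upwards [h.action s j,
        ae_restrict_of_ae (Lp.coeFn_smul c (p.2 s))] with x h1 h3
      rw [Prod.smul_snd, PiLp.smul_apply, h3, Pi.smul_apply, h1]
      simp only [quasiDeriv, Pi.smul_apply, smul_eq_mul]
      ring
    · simp only [Pi.smul_apply, h.cont_lower]
    · simp only [Pi.smul_apply, h.cont_left]
    · have h1 := h.delta j
      simp only [quasiDeriv, Pi.smul_apply, smul_eq_mul] at h1 ⊢
      linear_combination c * h1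

theorem HasSobolevDerivs.continuousOn {a b : ℝ} (hab : a ≤ b) {u v w : ℝ → ℂ}
    (h : HasSobolevDerivs a b u v w) : ContinuousOn u (Set.Icc a b) := by
  have hv := (h.intervalIntegrable (Set.right_mem_Icc.2 hab)).2
  rw [intervalIntegrable_iff_integrableOn_Icc_of_le hab] at hv
  exact (continuousOn_const.add (by
    simpa only [Set.uIcc_of_le hab] using intervalIntegral.continuousOn_primitive_interval
      (a := a) (b := b) (by rwa [Set.uIcc_of_le hab]))).congr h.self_eq

theorem HasSobolevDerivs.continuousOn_deriv {a b : ℝ} (hab : a ≤ b) {u v w : ℝ → ℂ}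
    (h : HasSobolevDerivs a b u v w) : ContinuousOn v (Set.Icc a b) := by
  have hw := (h.intervalIntegrable (Set.right_mem_Icc.2 hab)).1
  rw [intervalIntegrable_iff_integrableOn_Icc_of_le hab] at hw
  exact (continuousOn_const.add (by
    simpa only [Set.uIcc_of_le hab] using intervalIntegral.continuousOn_primitive_interval
      (a := a) (b := b) (by rwa [Set.uIcc_of_le hab]))).congr h.deriv_eq

/-- If the primitive of `f` vanishes on `[a, b]`, then so does `f`, almost everywhere. -/
theorem ae_zero_of_primitive_zero {a b : ℝ} (hab : a ≤ b) {f : ℝ → ℂ}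
    (hf : IntervalIntegrable f volume a b)
    (h : ∀ x ∈ Set.Icc a b, ∫ t in a..x, f t = 0) :
    ∀ᵐ x ∂(volume.restrict (Set.Ioo a b)), f x = 0 := by
  rw [ae_restrict_iff' measurableSet_Ioo]
  filter_upwards [hf.ae_hasDerivAt_integral] with x hx hxab
  have h1 := hx (by rw [Set.uIcc_of_le hab]; exact Set.Ioo_subset_Icc_self hxab) a
    Set.left_mem_uIcc
  have h2 : HasDerivAt (fun y => ∫ t in a..y, f t) 0 x := by
    refine (hasDerivAt_const x (0 : ℂ)).congr_of_eventuallyEq ?_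
    filter_upwards [isOpen_Ioo.mem_nhds hxab] with y hy
    exact h y (Set.Ioo_subset_Icc_self hy)
  exact h1.unique h2

/-- The derivatives of a function that vanishes almost everywhere vanish almost everywhere. -/
theorem HasSobolevDerivs.eq_zero {a b : ℝ} (hab : a < b) {u v w : ℝ → ℂ}
    (h : HasSobolevDerivs a b u v w) (hu : ∀ᵐ x ∂(volume.restrict (Set.Ioo a b)), u x = 0) :
    ∀ᵐ x ∂(volume.restrict (Set.Ioo a b)), u x = 0 ∧ v x = 0 ∧ w x = 0 := by
  have hint := h.intervalIntegrable (Set.right_mem_Icc.2 hab.le)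
  have hu0 : Set.EqOn u 0 (Set.Icc a b) := by
    refine Measure.eqOn_Icc_of_ae_eq volume hab.ne ?_ (h.continuousOn hab.le) continuousOn_const
    rw [← restrict_Ioo_eq_restrict_Icc]
    exact hu
  have hv : ∀ᵐ x ∂(volume.restrict (Set.Ioo a b)), v x = 0 := by
    refine ae_zero_of_primitive_zero hab.le hint.2 fun x hx => ?_
    have := h.self_eq x hx
    rw [hu0 hx, hu0 (Set.left_mem_Icc.2 hab.le)] at this
    simpa using this.symm
  have hv0 : Set.EqOn v 0 (Set.Icc a b) := by
    refine Measure.eqOn_Icc_of_ae_eq volume hab.ne ?_ (h.continuousOn_deriv hab.le)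
      continuousOn_const
    rw [← restrict_Ioo_eq_restrict_Icc]
    exact hv
  have hw : ∀ᵐ x ∂(volume.restrict (Set.Ioo a b)), w x = 0 := by
    refine ae_zero_of_primitive_zero hab.le hint.1 fun x hx => ?_
    have := h.deriv_eq x hx
    rw [hv0 hx, hv0 (Set.left_mem_Icc.2 hab.le)] at this
    simpa using this.symm
  filter_upwards [hu, hv, hw] with x h1 h2 h3 using ⟨h1, h2, h3⟩

/-- Almost every real number lies on some edge. -/
theorem ae_of_ae_edge {p : ℝ → Prop} (h : ∀ j, ∀ᵐ x ∂(volume.restrict (edge j)), p x) :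
    ∀ᵐ x ∂(volume : Measure ℝ), p x := by
  have h1 : ∀ᵐ x ∂(volume : Measure ℝ), ∀ j : ℤ, x ≠ j * Real.pi := by
    rw [ae_all_iff]
    intro j
    exact Measure.ae_ne volume _
  have h2 : ∀ᵐ x ∂(volume : Measure ℝ), ∀ j : ℤ, x ∈ edge j → p x := by
    rw [ae_all_iff]
    intro j
    exact (ae_restrict_iff' measurableSet_Ioo).1 (h j)
  filter_upwards [h1, h2] with x hx1 hx2
  have hpi := Real.pi_pos
  refine hx2 ⌊x / Real.pi⌋ ⟨lt_of_le_of_ne ?_ (hx1 _).symm, ?_⟩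
  · exact (le_div_iff₀ hpi).1 (Int.floor_le _)
  · exact (div_lt_iff₀ hpi).1 (Int.lt_floor_add_one _)

/-- The graph is single-valued, so that it is indeed the graph of a linear operator. -/
theorem hamiltonianGraph_functional (A : ℝ) (α : ℤ → ℝ) :
    ∀ p ∈ hamiltonianGraph A α, p.1 = 0 → p.2 = 0 := by
  rintro p ⟨u, v, w, h⟩ hp
  ext s
  refine ae_of_ae_edge fun j => ?_
  have hab : (j : ℝ) * Real.pi < (j + 1) * Real.pi := by
    nlinarith [Real.pi_pos]
  have hu : ∀ᵐ x ∂(volume.restrict (edge j)), u s j x = 0 := by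
    filter_upwards [h.ae_eq s j,
      ae_restrict_of_ae (Lp.coeFn_zero ℂ 2 (volume : Measure ℝ))] with x h1 h2
    rw [← h1, hp]
    exact h2
  filter_upwards [(h.sobolev s j).eq_zero hab hu, h.action s j,
    ae_restrict_of_ae (Lp.coeFn_zero ℂ 2 (volume : Measure ℝ))] with x h1 h2 h3
  refine h2.trans (Eq.trans ?_ h3.symm)
  simp [quasiDeriv, h1.1, h1.2.1, h1.2.2]

/-- The magnetic Laplacian on the chain graph with `δ`-couplings `α j`, as an unbounded operator
in `L²(Γ)`. -/
def hamiltonian (A : ℝ) (α : ℤ → ℝ) : L2Chain →ₗ.[ℂ] L2Chain :=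
  (hamiltonianGraph A α).toLinearPMap

theorem hamiltonian_graph (A : ℝ) (α : ℤ → ℝ) :
    (hamiltonian A α).graph = hamiltonianGraph A α :=
  Submodule.toLinearPMap_graph_eq _ (hamiltonianGraph_functional A α)

/-- The constant coupling `α`, changed by `γ j` at the vertices `j = 1, …, m`. -/
def perturbedCoupling (α : ℝ) (m : ℕ) (γ : ℤ → ℝ) (j : ℤ) : ℝ :=
  if 1 ≤ j ∧ j ≤ m then α + γ j else α

end

end RingChain

/-!
In the gauge `e^{± i A x}` the magnetic derivative becomes `d/dx`, so for `E < 1` a solution of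
`-𝒟²ψ - E ψ = f` on an edge is determined by its values at the two ends, and the condition at the
vertex `jπ` turns into the Jacobi equation
`disc (β j) E * q j - 2 cos (A π) (q (j + 1) + q (j - 1)) = source` for the vertex values `q`.

*Bottom of the spectrum.* Let `b` be the first energy at which `disc α b = 4 |cos (A π)|`. Below
`b` the Jacobi operator is diagonally dominant, hence invertible on `ℓ²`. At `b` it is a second
difference up to signs, or zero if `cos (A π) = 0`; since the second difference has no nonzero
solution in `ℓ²` of a half-line, a source that is supported near one vertex cannot be reached.

*Essential spectrum.* If two coupling sequences differ at finitely many vertices, then the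
operators agree on the functions that vanish at these vertices. The vertex values are functionals of
`(ψ, Hψ)`, so this is a condition of finite codimension, and finite codimension of the range and
finite dimension of the kernel are inherited. The range is closed because, in terms of the resolvent
at one very negative energy, it is the range of a bounded operator of finite codimension.

*Eigenvalue.* A decaying solution of the Jacobi equation outside a finite block is geometric;
eliminating it modifies the two corners of the block. The resulting symmetric matrix is positive
definite at very negative energies, while at `b` its quadratic form on the sequence of signs that
makes the unperturbed form vanish is `sinE b π * ∑ (β j - α) < 0`. Hence it is singular at some
`E < b`.
-/

namespace RingChain

noncomputable section

open Filter Topology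

/-! ### The solutions of `y'' = -E y` -/

/-- The solution of `y'' = -E y` with `y 0 = 1` and `y' 0 = 0`. Since `√` vanishes on negative
numbers, one of the two factors is always `1`, which covers both signs of `E` by one formula. -/
def cosE (E t : ℝ) : ℝ := Real.cos (√E * t) * Real.cosh (√(-E) * t)

/-- The solution of `y'' = -E y` with `y 0 = 0` and `y' 0 = 1`. The difference quotients `dslope`
stand for `sin x / x` and `sinh x / x`, continued to `x = 0`. -/
def sinE (E t : ℝ) : ℝ :=
  t * dslope Real.sin 0 (√E * t) * dslope Real.sinh 0 (√(-E) * t)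

theorem cosE_of_nonneg {E : ℝ} (hE : 0 ≤ E) (t : ℝ) : cosE E t = Real.cos (√E * t) := by
  simp [cosE, Real.sqrt_eq_zero'.2 (neg_nonpos.2 hE)]

theorem cosE_of_nonpos {E : ℝ} (hE : E ≤ 0) (t : ℝ) : cosE E t = Real.cosh (√(-E) * t) := by
  simp [cosE, Real.sqrt_eq_zero'.2 hE]

theorem sinE_of_pos {E : ℝ} (hE : 0 < E) (t : ℝ) : sinE E t = Real.sin (√E * t) / √E := by
  have : 0 < √E := Real.sqrt_pos.2 hE
  have hslope : √E * t * dslope Real.sin 0 (√E * t) = Real.sin (√E * t) := by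
    simpa using sub_smul_dslope Real.sin 0 (√E * t)
  simp only [← hslope, sinE, Real.sqrt_eq_zero'.2 (neg_nonpos.2 hE.le), zero_mul, dslope_same,
    Real.deriv_sinh, Real.cosh_zero]
  field_simp

theorem sinE_of_neg {E : ℝ} (hE : E < 0) (t : ℝ) : sinE E t = Real.sinh (√(-E) * t) / √(-E) := by
  have h := Real.sqrt_pos.2 (neg_pos.2 hE)
  have hslope : √(-E) * t * dslope Real.sinh 0 (√(-E) * t) = Real.sinh (√(-E) * t) := by
    simpa using sub_smul_dslope Real.sinh 0 (√(-E) * t)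
  simp only [← hslope, sinE, Real.sqrt_eq_zero'.2 hE.le, zero_mul, dslope_same, Real.deriv_sin,
    Real.cos_zero]
  field_simp

theorem sinE_energy_zero (t : ℝ) : sinE 0 t = t := by simp [sinE, dslope_same]

@[simp] theorem cosE_zero (E : ℝ) : cosE E 0 = 1 := by simp [cosE]

@[simp] theorem sinE_zero (E : ℝ) : sinE E 0 = 0 := by simp [sinE]

theorem hasDerivAt_cosE (E t : ℝ) : HasDerivAt (cosE E) (-E * sinE E t) t := by
  rcases lt_trichotomy E 0 with hE | rfl | hE
  · have hs := Real.sqrt_pos.2 (neg_pos.2 hE)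
    have hsq := Real.mul_self_sqrt (neg_pos.2 hE).le
    rw [funext (cosE_of_nonpos hE.le), sinE_of_neg hE]
    convert! ((hasDerivAt_id t).const_mul √(-E)).cosh using 1
    simp only [id, mul_one]
    nth_rw 1 [← hsq]
    field_simp
  · simpa [funext (cosE_of_nonneg le_rfl)] using hasDerivAt_const t (1 : ℝ)
  · have : 0 < √E := Real.sqrt_pos.2 hE
    have hsq := Real.mul_self_sqrt hE.le
    rw [funext (cosE_of_nonneg hE.le), sinE_of_pos hE]
    convert! ((hasDerivAt_id t).const_mul √E).cos using 1
    simp only [id, mul_one]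
    nth_rw 1 [← hsq]
    field_simp

theorem hasDerivAt_sinE (E t : ℝ) : HasDerivAt (sinE E) (cosE E t) t := by
  rcases lt_trichotomy E 0 with hE | rfl | hE
  · have hs := Real.sqrt_pos.2 (neg_pos.2 hE)
    rw [funext (sinE_of_neg hE), cosE_of_nonpos hE.le]
    convert! ((hasDerivAt_id t).const_mul √(-E)).sinh.div_const √(-E) using 1
    simp only [id, mul_one]
    field_simp
  · simpa [funext sinE_energy_zero, cosE] using hasDerivAt_id' t
  · have : 0 < √E := Real.sqrt_pos.2 hE
    rw [funext (sinE_of_pos hE), cosE_of_nonneg hE.le]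
    convert! ((hasDerivAt_id t).const_mul √E).sin.div_const √E using 1
    simp only [id, mul_one]
    field_simp

theorem cosE_sq_add (E t : ℝ) : cosE E t ^ 2 + E * sinE E t ^ 2 = 1 := by
  have hderiv (s : ℝ) : HasDerivAt (fun s => cosE E s ^ 2 + E * sinE E s ^ 2) 0 s := by
    convert! ((hasDerivAt_cosE E s).pow 2).add (((hasDerivAt_sinE E s).pow 2).const_mul E) using 1
    simp only [Nat.cast_ofNat]
    ring
  simpa using is_const_of_deriv_eq_zero (fun s => (hderiv s).differentiableAt)
    (fun s => (hderiv s).deriv) t 0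

theorem continuous_cosE (E : ℝ) : Continuous (cosE E) :=
  continuous_iff_continuousAt.2 fun t => (hasDerivAt_cosE E t).continuousAt

theorem continuous_sinE (E : ℝ) : Continuous (sinE E) :=
  continuous_iff_continuousAt.2 fun t => (hasDerivAt_sinE E t).continuousAt

theorem continuous_cosE_energy (t : ℝ) : Continuous fun E => cosE E t := by
  unfold cosE
  have := Real.continuous_cosh
  fun_prop

theorem continuous_dslope_of_differentiable {f : ℝ → ℝ} (hf : Differentiable ℝ f) (a : ℝ) :
    Continuous (dslope f a) :=
  continuousOn_univ.1 ((continuousOn_dslope univ_mem).2 ⟨hf.continuous.continuousOn, hf a⟩)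

theorem continuous_sinE_energy (t : ℝ) : Continuous fun E => sinE E t := by
  unfold sinE
  have hsin := continuous_dslope_of_differentiable Real.differentiable_sin 0
  have hsinh := continuous_dslope_of_differentiable Real.differentiable_sinh 0
  fun_prop

theorem sinE_pos {E t : ℝ} (hE : E < 1) (ht : 0 < t) (ht' : t ≤ Real.pi) : 0 < sinE E t := by
  rcases lt_trichotomy E 0 with h | rfl | h
  · have hs := Real.sqrt_pos.2 (neg_pos.2 h)
    rw [sinE_of_neg h]
    exact div_pos (Real.sinh_pos_iff.2 (by positivity)) hs
  · rwa [sinE_energy_zero]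
  · have hs := Real.sqrt_pos.2 h
    have hs1 : √E < 1 := by rwa [Real.sqrt_lt' one_pos, one_pow]
    rw [sinE_of_pos h]
    exact div_pos (Real.sin_pos_of_pos_of_lt_pi (by positivity) (by nlinarith)) hs

theorem sinE_pi_pos {E : ℝ} (hE : E < 1) : 0 < sinE E Real.pi := sinE_pos hE Real.pi_pos le_rfl

/-! ### The discriminant and the lower band edge -/

/-- The diagonal entry of the Jacobi matrix that belongs to the energy `E` and the coupling `β`:
the values `q j` of a solution of `-𝒟²ψ = Eψ` at the vertices satisfy
`disc (β j) E * q j = 2 cos(Aπ) * (q (j + 1) + q (j - 1))`. -/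
def disc (β E : ℝ) : ℝ := 4 * cosE E Real.pi + β * sinE E Real.pi

theorem continuous_disc (β : ℝ) : Continuous (disc β) :=
  ((continuous_cosE_energy _).const_mul 4).add ((continuous_sinE_energy _).const_mul β)

theorem disc_one (β : ℝ) : disc β 1 = -4 := by
  simp [disc, cosE_of_nonneg, sinE_of_pos]

theorem disc_mono {β β' E : ℝ} (hE : E < 1) (h : β ≤ β') : disc β E ≤ disc β' E := by
  have := mul_le_mul_of_nonneg_right h (sinE_pi_pos hE).le
  simp only [disc]
  linarith

theorem tendsto_disc_atBot (β : ℝ) : Tendsto (disc β) atBot atTop := by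
  have hsqrt : Tendsto (fun E : ℝ => √(-E)) atBot atTop :=
    Real.tendsto_sqrt_atTop.comp tendsto_neg_atBot_atTop
  refine tendsto_atTop_mono' _ ?_ hsqrt
  filter_upwards [eventually_lt_atBot 0, hsqrt.eventually_ge_atTop |β|] with E hE hβ
  rw [disc, cosE_of_nonpos hE.le, sinE_of_neg hE]
  set k := √(-E)
  have hk : 0 < k := Real.sqrt_pos.2 (neg_pos.2 hE)
  have hkπ : k ≤ k * Real.pi := le_mul_of_one_le_right hk.le (by linarith [Real.pi_gt_three])
  have hcosh : k ≤ 2 * Real.cosh (k * Real.pi) := by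
    rw [Real.cosh_eq]
    linarith [Real.add_one_le_exp (k * Real.pi), Real.exp_pos (-(k * Real.pi))]
  have hsinh : |β * (Real.sinh (k * Real.pi) / k)| ≤ Real.cosh (k * Real.pi) := by
    have : 0 ≤ Real.sinh (k * Real.pi) := Real.sinh_nonneg_iff.2 (by positivity)
    calc |β * (Real.sinh (k * Real.pi) / k)| = |β| / k * Real.sinh (k * Real.pi) := by
          rw [abs_mul, abs_of_nonneg (by positivity : 0 ≤ Real.sinh (k * Real.pi) / k)]
          ring
      _ ≤ 1 * Real.sinh (k * Real.pi) := by
          gcongr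
          exact (div_le_one hk).2 hβ
      _ ≤ Real.cosh (k * Real.pi) := by linarith [Real.sinh_lt_cosh (k * Real.pi)]
  linarith [neg_le_of_abs_le hsinh, Real.cosh_pos (k * Real.pi)]

theorem exists_first_eq_of_tendsto_atBot_atTop {f : ℝ → ℝ} (hf : Continuous f)
    (hlim : Tendsto f atBot atTop) {x₀ d : ℝ} (hx₀ : f x₀ < d) :
    ∃ b < x₀, f b = d ∧ ∀ x < b, d < f x := by
  let K : Set ℝ := {x | f x ≤ d}
  have hbdd : BddBelow K := by
    obtain ⟨M, hM⟩ := eventually_atBot.1 (hlim.eventually_gt_atTop d)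
    exact ⟨M, fun x hx => not_lt.1 fun hlt => (hM x hlt.le).not_ge hx⟩
  have hmem : sInf K ∈ K := (isClosed_le hf continuous_const).csInf_mem ⟨x₀, hx₀.le⟩ hbdd
  have hlt (x : ℝ) (hx : x < sInf K) : d < f x := not_le.1 fun hle => hx.not_ge (csInf_le hbdd hle)
  have heq : f (sInf K) = d := hmem.antisymm <|
    ge_of_tendsto hf.continuousWithinAt (eventually_of_mem self_mem_nhdsWithin
      fun x (hx : x ∈ Set.Iio (sInf K)) => (hlt x hx).le)
  exact ⟨sInf K, (csInf_le hbdd hx₀.le).lt_of_ne fun h => hx₀.ne (h ▸ heq), heq, hlt⟩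

/-- `b` is the lowest energy at which the discriminant for the coupling `α` reaches `2|c|`. For
`c = 2 cos(Aπ)` this is the lower edge of the first band of the unperturbed chain. -/
structure IsBandEdge (c α b : ℝ) : Prop where
  lt_one : b < 1
  disc_eq : disc α b = 2 * |c|
  lt_disc : ∀ E < b, 2 * |c| < disc α E

theorem exists_isBandEdge (c α : ℝ) : ∃ b, IsBandEdge c α b := by
  have h1 : disc α 1 < 2 * |c| := by
    rw [disc_one]
    linarith [abs_nonneg c]
  obtain ⟨b, hb1, hb, hlt⟩ :=
    exists_first_eq_of_tendsto_atBot_atTop (continuous_disc α) (tendsto_disc_atBot α) h1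
  exact ⟨b, hb1, hb, hlt⟩

/-! ### Bound states of Jacobi matrices -/

section SignChange

open Matrix

variable {n : Type*} [Fintype n]

theorem dotProduct_mulVec_eq_norm_sq_mul (M : Matrix n n ℝ) (v : n → ℝ) :
    v ⬝ᵥ (M *ᵥ v) = ‖v‖ ^ 2 * ((‖v‖⁻¹ • v) ⬝ᵥ (M *ᵥ (‖v‖⁻¹ • v))) := by
  rcases eq_or_ne v 0 with rfl | hv
  · simp
  · have := norm_ne_zero_iff.2 hv
    simp only [mulVec_smul, dotProduct_smul, smul_dotProduct, smul_eq_mul]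
    field_simp

theorem posSemidef_of_nonneg_on_sphere {M : Matrix n n ℝ} (hM : M.IsHermitian)
    (h : ∀ v ∈ Metric.sphere (0 : n → ℝ) 1, 0 ≤ v ⬝ᵥ (M *ᵥ v)) : M.PosSemidef :=
  .of_dotProduct_mulVec_nonneg hM fun v => by
    rcases eq_or_ne v 0 with rfl | hv
    · simp
    · rw [star_trivial, dotProduct_mulVec_eq_norm_sq_mul]
      exact mul_nonneg (sq_nonneg _) (h _ (by simp [norm_smul, hv]))

theorem exists_mulVec_eq_zero_of_sign_change {N : ℝ → Matrix n n ℝ} (hN : Continuous N)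
    (hherm : ∀ t, (N t).IsHermitian) {s t : ℝ} (hst : s ≤ t)
    (hs : (N s).PosDef) {v₀ : n → ℝ} (ht : v₀ ⬝ᵥ (N t *ᵥ v₀) < 0) :
    ∃ r < t, ∃ v ≠ 0, N r *ᵥ v = 0 := by
  let S : Set (n → ℝ) := Metric.sphere 0 1
  let form (r : ℝ) (v : n → ℝ) : ℝ := v ⬝ᵥ (N r *ᵥ v)
  have hform : Continuous (Function.uncurry form) :=
    continuous_snd.dotProduct ((hN.comp continuous_fst).matrix_mulVec continuous_snd)
  have hv₀ : v₀ ≠ 0 := by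
    rintro rfl
    simp at ht
  have hv₀S : ‖v₀‖⁻¹ • v₀ ∈ S := by simp [S, norm_smul, hv₀]
  have hS : IsCompact S := isCompact_sphere 0 1
  have hmin (r : ℝ) : ∃ v ∈ S, sInf (form r '' S) = form r v ∧ ∀ w ∈ S, form r v ≤ form r w :=
    hS.exists_sInf_image_eq_and_le ⟨_, hv₀S⟩ (hform.comp (.prodMk_right r)).continuousOn
  have hμ : Continuous fun r => sInf (form r '' S) := hS.continuous_sInf hform
  have hμs : 0 < sInf (form s '' S) := by
    obtain ⟨v, hv, heq, -⟩ := hmin s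
    exact heq ▸ hs.dotProduct_mulVec_pos (ne_zero_of_mem_unit_sphere ⟨v, hv⟩)
  have hμt : sInf (form t '' S) < 0 := by
    obtain ⟨v, -, heq, hle⟩ := hmin t
    rw [dotProduct_mulVec_eq_norm_sq_mul] at ht
    exact heq.trans_lt ((hle _ hv₀S).trans_lt (neg_of_mul_neg_right ht (sq_nonneg _)))
  obtain ⟨r, hr, hr0⟩ := intermediate_value_Icc' hst hμ.continuousOn ⟨hμt.le, hμs.le⟩
  obtain ⟨v, hv, heq, hle⟩ := hmin r
  have hpos : (N r).PosSemidef := posSemidef_of_nonneg_on_sphere (hherm r) fun w hw =>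
    (hr0.symm.trans heq).trans_le (hle w hw)
  refine ⟨r, hr.2.lt_of_ne ?_, v, ne_zero_of_mem_unit_sphere ⟨v, hv⟩,
    (hpos.dotProduct_mulVec_zero_iff v).1 (heq.symm.trans hr0)⟩
  rintro rfl
  exact hμt.ne hr0

end SignChange

/-- The value `c * x` for the decaying solution `q j = x ^ j` of
`D * q j = c (q (j + 1) + q (j - 1))` on a half-line, see `exists_decay_ratio`.
Unlike `x` itself, it is given by a formula without division by `c`, which may vanish. -/
def exteriorCoupling (c D : ℝ) : ℝ := (D - √(D ^ 2 - 4 * c ^ 2)) / 2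

theorem continuous_exteriorCoupling (c : ℝ) : Continuous (exteriorCoupling c) := by
  unfold exteriorCoupling
  fun_prop

theorem exteriorCoupling_two_mul_abs (c : ℝ) : exteriorCoupling c (2 * |c|) = |c| := by
  rw [exteriorCoupling, mul_pow, sq_abs]
  norm_num

theorem exists_decay_ratio {c D : ℝ} (hD : 2 * |c| < D) :
    ∃ x, |x| < 1 ∧ c * x = exteriorCoupling c D ∧ c * (x ^ 2 + 1) = D * x := by
  have hD0 : 0 < D := (by positivity : 0 ≤ 2 * |c|).trans_lt hD
  have hsq := Real.sq_sqrt (show 0 ≤ D ^ 2 - 4 * c ^ 2 by nlinarith [sq_abs c, abs_nonneg c])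
  have hs := Real.sqrt_nonneg (D ^ 2 - 4 * c ^ 2)
  simp only [exteriorCoupling]
  set s := √(D ^ 2 - 4 * c ^ 2)
  refine ⟨2 * c / (D + s), ?_, ?_, ?_⟩
  · rw [abs_div, abs_mul, abs_two, abs_of_pos (by linarith : 0 < D + s), div_lt_one (by linarith)]
    linarith
  · field_simp
    linear_combination hsq
  · field_simp
    linear_combination c * hsq

theorem exteriorCoupling_le_abs {c D : ℝ} (hD : 2 * |c| < D) : exteriorCoupling c D ≤ |c| := by
  obtain ⟨x, hx, hcx, -⟩ := exists_decay_ratio hD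
  calc exteriorCoupling c D ≤ |c * x| := hcx ▸ le_abs_self _
    _ ≤ |c| := by
      rw [abs_mul]
      exact mul_le_of_le_one_right (abs_nonneg c) hx.le

section BoundaryJacobi

open Matrix

/-- The Jacobi matrix on the sites `a, …, b` with diagonal `d` and off-diagonal entries `-c`, whose
two corner entries are lowered by `κ`. For `κ = c * x` its kernel consists of the restrictions of
those solutions of the Jacobi equation that continue as multiples of `x ^ n` beyond both ends. -/
def boundaryJacobi (a b : ℤ) (c κ : ℝ) (d : ℤ → ℝ) : Matrix (Set.Icc a b) (Set.Icc a b) ℝ :=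
  Matrix.of fun i j =>
    (if j = i then d i - (if (i : ℤ) = a then κ else 0) - (if (i : ℤ) = b then κ else 0) else 0)
      - (if (j : ℤ) = i + 1 then c else 0) - (if (j : ℤ) = i - 1 then c else 0)

variable {a b : ℤ} {c κ : ℝ} {d : ℤ → ℝ}

theorem isHermitian_boundaryJacobi : (boundaryJacobi a b c κ d).IsHermitian := by
  ext i j
  simp only [conjTranspose_apply, boundaryJacobi, of_apply, star_trivial]
  grind

theorem continuous_boundaryJacobi {κ : ℝ → ℝ} {d : ℤ → ℝ → ℝ} (hκ : Continuous κ)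
    (hd : ∀ j, Continuous (d j)) :
    Continuous fun t => boundaryJacobi a b c (κ t) (fun j => d j t) := by
  refine continuous_matrix fun i j => ?_
  have := hd i
  simp only [boundaryJacobi, of_apply]
  split_ifs <;> fun_prop

theorem boundaryJacobi_mulVec (q : ℤ → ℝ) (i : Set.Icc a b) :
    (boundaryJacobi a b c κ d *ᵥ fun j => q j) i =
      d i * q i - (if (i : ℤ) = a then κ * q i else 0) - (if (i : ℤ) = b then κ * q i else 0)
        - (if (i : ℤ) < b then c * q (i + 1) else 0)
        - (if a < (i : ℤ) then c * q (i - 1) else 0) := by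
  have hsum (k : ℤ) (r : ℝ) : (∑ j : Set.Icc a b, (if (j : ℤ) = k then r else 0) * q j) =
      if k ∈ Set.Icc a b then r * q k else 0 := by
    rw [Finset.sum_set_coe (f := fun j : ℤ => (if j = k then r else 0) * q j)]
    simp [ite_mul]
  have hi := i.2
  simp only [mulVec, dotProduct, boundaryJacobi, of_apply, sub_mul, Finset.sum_sub_distrib, hsum,
    ← Subtype.coe_inj]
  simp only [Set.mem_Icc] at hi ⊢
  grind

theorem sum_Ioc_eq_sum_Ico_succ (a b : ℤ) (f : ℤ → ℝ) :
    ∑ j ∈ Finset.Ioc a b, f j = ∑ j ∈ Finset.Ico a b, f (j + 1) := by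
  rw [Finset.sum_Ico_add' f a b 1]
  congr 1
  ext j
  simp only [Finset.mem_Ioc, Finset.mem_Ico]
  lia

theorem two_mul_sum_Icc (hab : a ≤ b) (f : ℤ → ℝ) :
    2 * ∑ j ∈ Finset.Icc a b, f j = ∑ j ∈ Finset.Ico a b, (f j + f (j + 1)) + (f a + f b) := by
  rw [Finset.sum_add_distrib, ← sum_Ioc_eq_sum_Ico_succ]
  linarith [Finset.sum_Ioc_add_eq_sum_Icc (f := f) hab, Finset.sum_Ico_add_eq_sum_Icc (f := f) hab]

theorem dotProduct_boundaryJacobi_mulVec (hab : a ≤ b) (q : ℤ → ℝ) :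
    (fun j : Set.Icc a b => q j) ⬝ᵥ (boundaryJacobi a b c κ d *ᵥ fun j => q j) =
      ∑ j ∈ Finset.Icc a b, d j * q j ^ 2 - κ * (q a ^ 2 + q b ^ 2)
        - ∑ j ∈ Finset.Ico a b, 2 * c * (q j * q (j + 1)) := by
  have hright : ∑ j ∈ Finset.Icc a b, (if j < b then q j * (c * q (j + 1)) else 0) =
      ∑ j ∈ Finset.Ico a b, c * (q j * q (j + 1)) := by
    rw [← Finset.sum_filter]
    exact Finset.sum_congr (by grind) fun j _ => by ring
  have hleft : ∑ j ∈ Finset.Icc a b, (if a < j then q j * (c * q (j - 1)) else 0) =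
      ∑ j ∈ Finset.Ico a b, c * (q j * q (j + 1)) := by
    rw [← Finset.sum_filter, show (Finset.Icc a b).filter (a < ·) = Finset.Ioc a b by grind,
      sum_Ioc_eq_sum_Ico_succ]
    exact Finset.sum_congr rfl fun j _ => by rw [add_sub_cancel_right]; ring
  simp only [dotProduct, boundaryJacobi_mulVec]
  rw [Finset.sum_set_coe (f := fun j : ℤ => q j * (d j * q j - (if j = a then κ * q j else 0)
    - (if j = b then κ * q j else 0) - (if j < b then c * q (j + 1) else 0)
    - (if a < j then c * q (j - 1) else 0)))]
  simp only [mul_sub, mul_ite, mul_zero, Finset.sum_sub_distrib, Set.toFinset_Icc, hright, hleft,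
    Finset.sum_ite_eq', Finset.left_mem_Icc.2 hab, Finset.right_mem_Icc.2 hab, if_true,
    mul_assoc, ← Finset.mul_sum]
  have hdiag (j : ℤ) : q j * (d j * q j) = d j * q j ^ 2 := by ring
  simp only [hdiag]
  ring

theorem posDef_boundaryJacobi (hab : a ≤ b) (hκ : κ ≤ |c|) (hd : ∀ j ∈ Set.Icc a b, 2 * |c| < d j) :
    (boundaryJacobi a b c κ d).PosDef := by
  refine .of_dotProduct_mulVec_pos isHermitian_boundaryJacobi fun v hv => ?_
  obtain ⟨q, rfl⟩ : ∃ q : ℤ → ℝ, (fun j : Set.Icc a b => q j) = v :=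
    ⟨Set.IccExtend hab v, funext fun j => Set.IccExtend_val hab v j⟩
  obtain ⟨i, hi⟩ := Function.ne_iff.1 hv
  have hdiag : ∑ j ∈ Finset.Icc a b, 2 * |c| * q j ^ 2 < ∑ j ∈ Finset.Icc a b, d j * q j ^ 2 :=
    Finset.sum_lt_sum
      (fun j hj => mul_le_mul_of_nonneg_right (hd j (Finset.mem_Icc.1 hj)).le (sq_nonneg _))
      ⟨i, Finset.mem_Icc.2 i.2, mul_lt_mul_of_pos_right (hd i i.2) (sq_pos_of_ne_zero hi)⟩
  have hoff (x y : ℝ) : 2 * c * (x * y) ≤ |c| * (x ^ 2 + y ^ 2) := by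
    calc 2 * c * (x * y) ≤ |c * (2 * x * y)| := (by ring : _ = _).trans_le (le_abs_self _)
      _ ≤ |c| * (x ^ 2 + y ^ 2) := by
        rw [abs_mul]
        gcongr
        exact abs_le.2 ⟨by nlinarith [sq_nonneg (x + y)], two_mul_le_add_sq x y⟩
  have hends := mul_le_mul_of_nonneg_right hκ (add_nonneg (sq_nonneg (q a)) (sq_nonneg (q b)))
  have hsum := Finset.sum_le_sum fun j (_ : j ∈ Finset.Ico a b) => hoff (q j) (q (j + 1))
  have htwo := two_mul_sum_Icc hab fun j => q j ^ 2
  rw [star_trivial, dotProduct_boundaryJacobi_mulVec hab]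
  simp only [← Finset.mul_sum] at hdiag hsum ⊢
  linear_combination hdiag + hsum + hends - |c| * htwo

theorem exists_sq_eq_one_mul_eq_abs (c : ℝ) : ∃ σ : ℝ, σ ^ 2 = 1 ∧ c * σ = |c| := by
  rcases abs_cases c with ⟨h, -⟩ | ⟨h, -⟩
  exacts [⟨1, by simp [h]⟩, ⟨-1, by simp [h]⟩]

theorem exists_dotProduct_boundaryJacobi_neg (hab : a ≤ b)
    (hd : ∑ j ∈ Finset.Icc a b, (d j - 2 * |c|) < 0) :
    ∃ v, v ⬝ᵥ (boundaryJacobi a b c |c| d *ᵥ v) < 0 := by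
  obtain ⟨σ, hσ, hcσ⟩ := exists_sq_eq_one_mul_eq_abs c
  have hσ0 : σ ≠ 0 := by
    rintro rfl
    norm_num at hσ
  have hsq (j : ℤ) : (σ ^ j) ^ 2 = 1 := by
    rw [← zpow_natCast, zpow_comm, zpow_natCast, hσ, _root_.one_zpow]
  have hoff (j : ℤ) : 2 * c * (σ ^ j * σ ^ (j + 1)) = |c| * ((σ ^ j) ^ 2 + (σ ^ (j + 1)) ^ 2) := by
    rw [hsq, hsq, zpow_add_one₀ hσ0]
    linear_combination 2 * c * σ * hsq j + 2 * hcσ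
  have hdiag : ∑ j ∈ Finset.Icc a b, d j * (σ ^ j) ^ 2 -
      2 * |c| * ∑ j ∈ Finset.Icc a b, (σ ^ j) ^ 2 < 0 := by
    simpa only [hsq, mul_one, Finset.mul_sum, ← Finset.sum_sub_distrib] using hd
  have htwo := two_mul_sum_Icc hab fun j => (σ ^ j) ^ 2
  refine ⟨fun j => σ ^ (j : ℤ), ?_⟩
  rw [dotProduct_boundaryJacobi_mulVec hab fun j => σ ^ j]
  simp only [hoff, ← Finset.mul_sum]
  linear_combination hdiag + |c| * htwo

end BoundaryJacobi

theorem summable_int_of_tails {f : ℤ → ℝ} {a b : ℤ} (ha : Summable fun n : ℕ => f (a - n))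
    (hb : Summable fun n : ℕ => f (b + n)) : Summable f := by
  have htail {g : ℤ → ℝ} {k : ℤ} (hg : Summable fun n : ℕ => g (k + n)) :
      Summable fun n : ℕ => g n := by
    refine (summable_nat_add_iff k.toNat).1 ?_
    convert! hg.comp_injective (add_left_injective (k.toNat - k).toNat) using 2 with n
    dsimp
    congr 1
    lia
  refine .of_nat_of_neg (htail hb) (htail (g := fun j => f (-j)) (k := -a) ?_)
  simpa [sub_eq_add_neg, add_comm] using ha

/-- The continuation of `v` to all sites by multiples of `x ^ n` beyond both ends of `[a, b]`. -/
def geomExtend {a b : ℤ} (hab : a ≤ b) (x : ℝ) (v : Set.Icc a b → ℝ) (j : ℤ) : ℝ :=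
  x ^ (j - Set.projIcc a b hab j).natAbs * v (Set.projIcc a b hab j)

section GeomExtend

open Matrix

variable {a b : ℤ} {hab : a ≤ b} {x : ℝ} {v : Set.Icc a b → ℝ}

theorem geomExtend_coe (j : Set.Icc a b) : geomExtend hab x v j = v j := by
  simp [geomExtend]

theorem geomExtend_left_sub (n : ℕ) :
    geomExtend hab x v (a - n) = x ^ n * v ⟨a, Set.left_mem_Icc.2 hab⟩ := by
  simp [geomExtend, Set.projIcc_of_le_left hab (show a - n ≤ a by lia)]

theorem geomExtend_right_add (n : ℕ) :
    geomExtend hab x v (b + n) = x ^ n * v ⟨b, Set.right_mem_Icc.2 hab⟩ := by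
  simp [geomExtend, Set.projIcc_of_right_le hab (show b ≤ b + n by lia)]

theorem summable_geomExtend_sq (hx : |x| < 1) : Summable fun j => geomExtend hab x v j ^ 2 := by
  have hgeom (r : ℝ) : Summable fun n : ℕ => (x ^ n * r) ^ 2 := by
    have hx2 : x ^ 2 < 1 := (sq_lt_one_iff_abs_lt_one x).2 hx
    convert! (summable_geometric_of_lt_one (sq_nonneg x) hx2).mul_right (r ^ 2) using 2 with n
    ring
  exact summable_int_of_tails (a := a) (b := b) (by simpa only [geomExtend_left_sub] using hgeom _)
    (by simpa only [geomExtend_right_add] using hgeom _)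

theorem geomExtend_jacobi {c D : ℝ} {d : ℤ → ℝ} (hx : c * (x ^ 2 + 1) = D * x)
    (hd : ∀ j ∉ Set.Icc a b, d j = D) (hv : boundaryJacobi a b c (c * x) d *ᵥ v = 0) (j : ℤ) :
    d j * geomExtend hab x v j =
      c * (geomExtend hab x v (j + 1) + geomExtend hab x v (j - 1)) := by
  have hleft := geomExtend_left_sub (hab := hab) (x := x) (v := v)
  have hright := geomExtend_right_add (hab := hab) (x := x) (v := v)
  rcases lt_or_ge j a with hja | hja
  · obtain ⟨n, rfl⟩ : ∃ n : ℕ, j = a - (n + 1 : ℕ) := ⟨(a - j - 1).toNat, by lia⟩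
    have hprev : a - (n + 1 : ℕ) - 1 = a - (n + 2 : ℕ) := by lia
    have hnext : a - (n + 1 : ℕ) + 1 = a - n := by lia
    rw [hprev, hnext, hd _ (by simp), hleft, hleft, hleft]
    linear_combination -(x ^ n * v ⟨a, Set.left_mem_Icc.2 hab⟩) * hx
  rcases lt_or_ge b j with hjb | hjb
  · obtain ⟨n, rfl⟩ : ∃ n : ℕ, j = b + (n + 1 : ℕ) := ⟨(j - b - 1).toNat, by lia⟩
    have hprev : b + (n + 1 : ℕ) - 1 = b + n := by lia
    have hnext : b + (n + 1 : ℕ) + 1 = b + (n + 2 : ℕ) := by lia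
    rw [hprev, hnext, hd _ (by simp), hright, hright, hright]
    linear_combination -(x ^ n * v ⟨b, Set.right_mem_Icc.2 hab⟩) * hx
  have hrow := congrFun hv ⟨j, hja, hjb⟩
  rw [← funext (geomExtend_coe (hab := hab) (x := x) (v := v)), boundaryJacobi_mulVec] at hrow
  have hleft1 : geomExtend hab x v (a - 1) = x * geomExtend hab x v a := by
    simpa [← geomExtend_coe (hab := hab) (x := x)] using hleft 1
  have hright1 : geomExtend hab x v (b + 1) = x * geomExtend hab x v b := by
    simpa [← geomExtend_coe (hab := hab) (x := x)] using hright 1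
  simp only [Pi.zero_apply] at hrow
  grind

end GeomExtend

theorem IsBandEdge.disc_sub_two_mul_abs {c α E₀ : ℝ} (h : IsBandEdge c α E₀) (β : ℝ) :
    disc β E₀ - 2 * |c| = (β - α) * sinE E₀ Real.pi := by
  rw [← h.disc_eq, disc, disc]
  ring

theorem exists_bound_state {c α E₀ : ℝ} (hE₀ : IsBandEdge c α E₀) {β : ℤ → ℝ} {S : Finset ℤ}
    (hβ : ∀ j ∉ S, β j = α) (hneg : ∑ j ∈ S, (β j - α) < 0) :
    ∃ E < E₀, ∃ q : ℤ → ℝ, (∃ j, q j ≠ 0) ∧ (Summable fun j => q j ^ 2) ∧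
      ∀ j, disc (β j) E * q j = c * (q (j + 1) + q (j - 1)) := by
  obtain ⟨K, hK⟩ : ∃ K : ℕ, S ⊆ Finset.Icc (-K : ℤ) K := by
    refine ⟨S.sup Int.natAbs, fun j hj => Finset.mem_Icc.2 ?_⟩
    have := Finset.le_sup (f := Int.natAbs) hj
    lia
  have hab : (-K : ℤ) ≤ K := by lia
  have hout (j : ℤ) (hj : j ∉ Set.Icc (-K : ℤ) K) : β j = α :=
    hβ j fun hjS => hj (Finset.mem_Icc.1 (hK hjS))
  let N (E : ℝ) :=
    boundaryJacobi (-K) K c (exteriorCoupling c (disc α E)) fun j => disc (β j) E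
  have hN : Continuous N :=
    continuous_boundaryJacobi ((continuous_exteriorCoupling c).comp (continuous_disc α))
      fun j => continuous_disc (β j)
  obtain ⟨s, hs, hpos⟩ : ∃ s < E₀, (N s).PosDef := by
    obtain ⟨s, hs, hlarge⟩ := ((eventually_lt_atBot E₀).and
      ((Set.finite_Icc (-K : ℤ) K).eventually_all.2 fun j _ =>
        (tendsto_disc_atBot (β j)).eventually_gt_atTop (2 * |c|))).exists
    exact ⟨s, hs, posDef_boundaryJacobi hab (exteriorCoupling_le_abs (hE₀.lt_disc s hs)) hlarge⟩
  obtain ⟨v₀, hv₀⟩ : ∃ v₀, v₀ ⬝ᵥ (N E₀).mulVec v₀ < 0 := by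
    simp only [N, hE₀.disc_eq, exteriorCoupling_two_mul_abs]
    refine exists_dotProduct_boundaryJacobi_neg hab ?_
    rw [Finset.sum_congr rfl fun j _ => hE₀.disc_sub_two_mul_abs (β j), ← Finset.sum_mul,
      ← Finset.sum_subset hK fun j _ hj => by rw [hβ j hj, sub_self]]
    exact mul_neg_of_neg_of_pos hneg (sinE_pi_pos hE₀.lt_one)
  obtain ⟨E, hE, v, hv, hker⟩ :=
    exists_mulVec_eq_zero_of_sign_change hN (fun _ => isHermitian_boundaryJacobi) hs.le hpos hv₀
  obtain ⟨x, hx, hcx, hrec⟩ := exists_decay_ratio (hE₀.lt_disc E hE)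
  obtain ⟨i, hi⟩ := Function.ne_iff.1 hv
  refine ⟨E, hE, geomExtend hab x v, ⟨i, by rwa [geomExtend_coe]⟩, summable_geomExtend_sq hx,
    geomExtend_jacobi hrec (fun j hj => by rw [hout j hj]) ?_⟩
  rwa [hcx]

/-! ### The Jacobi equation in `ℓ²(ℤ)` -/

section NeumannSeries

variable {X : Type*} [NormedAddCommGroup X] [NormedSpace ℂ X] {T : X →L[ℂ] X} {k : ℝ}

theorem norm_le_div_of_sub_map_eq (hT : ‖T‖ ≤ k) (hk : k < 1) {q r : X} (hq : q - T q = r) :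
    ‖q‖ ≤ ‖r‖ / (1 - k) := by
  have hle : ‖q‖ ≤ ‖r‖ + k * ‖q‖ :=
    calc ‖q‖ = ‖r + T q‖ := by rw [← hq, sub_add_cancel]
      _ ≤ ‖r‖ + k * ‖q‖ := norm_add_le_of_le le_rfl (T.le_of_opNorm_le hT q)
  rw [le_div_iff₀ (sub_pos.2 hk)]
  linarith

theorem exists_sub_map_eq [CompleteSpace X] (hT : ‖T‖ < 1) (r : X) : ∃ q, q - T q = r := by
  obtain ⟨u, hu⟩ := isUnit_one_sub_of_norm_lt_one hT
  have hinv : (u : X →L[ℂ] X) ((↑u⁻¹ : X →L[ℂ] X) r) = r :=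
    DFunLike.congr_fun (u.mul_inv : (u : X →L[ℂ] X) * ↑u⁻¹ = 1) r
  exact ⟨(↑u⁻¹ : X →L[ℂ] X) r, by rwa [hu] at hinv⟩

end NeumannSeries

theorem memℓp_two_iff {x : ℤ → ℂ} : Memℓp x 2 ↔ Summable fun j => ‖x j‖ ^ 2 := by
  rw [memℓp_gen_iff (by norm_num)]
  norm_num

theorem lp_two_norm_sq (x : lp (fun _ : ℤ => ℂ) 2) : ‖x‖ ^ 2 = ∑' j, ‖x j‖ ^ 2 := by
  simpa using lp.norm_rpow_eq_tsum (p := 2) (by norm_num) x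

section WeightedNeighbours

variable {a : ℤ → ℂ} {k : ℝ}

theorem hasSum_neighbours_sq {x : ℤ → ℂ} (hx : Summable fun j => ‖x j‖ ^ 2) :
    HasSum (fun j => 2 * (‖x (j + 1)‖ ^ 2 + ‖x (j - 1)‖ ^ 2)) (2 ^ 2 * ∑' j, ‖x j‖ ^ 2) := by
  have hright := (Equiv.addRight (1 : ℤ)).hasSum_iff.2 hx.hasSum
  have hleft := (Equiv.subRight (1 : ℤ)).hasSum_iff.2 hx.hasSum
  convert! (hright.add hleft).mul_left 2 using 1
  ring

theorem norm_weighted_neighbours_sq_le (ha : ∀ j, ‖a j‖ ≤ k) (x : ℤ → ℂ) (j : ℤ) :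
    ‖a j * (x (j + 1) + x (j - 1))‖ ^ 2 ≤
      k ^ 2 * (2 * (‖x (j + 1)‖ ^ 2 + ‖x (j - 1)‖ ^ 2)) := by
  rw [norm_mul, mul_pow]
  gcongr
  · exact ha j
  · exact (pow_le_pow_left₀ (norm_nonneg _) (norm_add_le _ _) 2).trans add_sq_le

theorem exists_weighted_neighbours_operator (ha : ∀ j, ‖a j‖ ≤ k) :
    ∃ T : lp (fun _ : ℤ => ℂ) 2 →L[ℂ] lp (fun _ : ℤ => ℂ) 2,
      ‖T‖ ≤ k * 2 ∧ ∀ x j, T x j = a j * (x (j + 1) + x (j - 1)) := by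
  have hk : 0 ≤ k := (norm_nonneg _).trans (ha 0)
  have hsum (x : lp (fun _ : ℤ => ℂ) 2) :=
    (hasSum_neighbours_sq (memℓp_two_iff.1 x.2)).mul_left (k ^ 2)
  have hmem (x : lp (fun _ : ℤ => ℂ) 2) :
      Summable fun j => ‖a j * (x (j + 1) + x (j - 1))‖ ^ 2 :=
    (hsum x).summable.of_nonneg_of_le (fun j => sq_nonneg _) (norm_weighted_neighbours_sq_le ha x)
  let T : lp (fun _ : ℤ => ℂ) 2 →ₗ[ℂ] lp (fun _ : ℤ => ℂ) 2 :=
    { toFun := fun x => ⟨fun j => a j * (x (j + 1) + x (j - 1)), memℓp_two_iff.2 (hmem x)⟩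
      map_add' := fun x y => by
        ext j
        simp only [lp.coeFn_add, Pi.add_apply]
        ring
      map_smul' := fun z x => by
        ext j
        simp only [lp.coeFn_smul, Pi.smul_apply, smul_eq_mul, RingHom.id_apply]
        ring }
  have hT (x : lp (fun _ : ℤ => ℂ) 2) : ‖T x‖ ≤ k * 2 * ‖x‖ := by
    refine le_of_sq_le_sq ?_ (by positivity)
    rw [mul_pow, mul_pow, mul_assoc, lp_two_norm_sq, lp_two_norm_sq]
    exact hasSum_le (norm_weighted_neighbours_sq_le ha x) (hmem x).hasSum (hsum x)
  exact ⟨T.mkContinuous _ hT, T.mkContinuous_norm_le (by positivity) hT, fun x j => rfl⟩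

end WeightedNeighbours

section DominantDiagonal

variable {d : ℤ → ℝ} {c D : ℝ}

theorem pos_of_two_mul_abs_lt (hD : 2 * |c| < D) : 0 < D :=
  (by positivity : 0 ≤ 2 * |c|).trans_lt hD

theorem exists_jacobi_operator (hD : 2 * |c| < D) (hd : ∀ j, D ≤ d j) :
    ∃ T : lp (fun _ : ℤ => ℂ) 2 →L[ℂ] lp (fun _ : ℤ => ℂ) 2,
      ‖T‖ ≤ |c| / D * 2 ∧ |c| / D * 2 < 1 ∧ ∀ q r : lp (fun _ : ℤ => ℂ) 2,
        q - T q = r ↔ ∀ j, d j * q j - c * (q (j + 1) + q (j - 1)) = d j * r j := by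
  have hD0 : 0 < D := pos_of_two_mul_abs_lt hD
  have hweight (j : ℤ) : ‖((c / d j : ℝ) : ℂ)‖ ≤ |c| / D := by
    rw [Complex.norm_real, Real.norm_eq_abs, abs_div, abs_of_pos (hD0.trans_le (hd j))]
    gcongr
    exact hd j
  obtain ⟨T, hT, hTapply⟩ := exists_weighted_neighbours_operator hweight
  refine ⟨T, hT, by rwa [div_mul_eq_mul_div, div_lt_one hD0, mul_comm], fun q r => ?_⟩
  rw [lp.ext_iff, funext_iff]
  refine forall_congr' fun j => ?_
  have hdj : (d j : ℂ) ≠ 0 := by exact_mod_cast (hD0.trans_le (hd j)).ne'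
  rw [lp.coeFn_sub, Pi.sub_apply, hTapply, ← mul_right_inj' hdj, mul_sub]
  push_cast
  rw [← mul_assoc, mul_div_cancel₀ _ hdj]

theorem jacobi_eq_zero (hD : 2 * |c| < D) (hd : ∀ j, D ≤ d j) {q : ℤ → ℂ}
    (hq : Summable fun j => ‖q j‖ ^ 2)
    (h : ∀ j, d j * q j - c * (q (j + 1) + q (j - 1)) = 0) : q = 0 := by
  obtain ⟨T, hT, hlt, hiff⟩ := exists_jacobi_operator hD hd
  have hle := norm_le_div_of_sub_map_eq hT hlt
    ((hiff ⟨q, memℓp_two_iff.2 hq⟩ 0).2 fun j => by simpa using h j)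
  rw [norm_zero, zero_div, norm_le_zero_iff] at hle
  exact congrArg Subtype.val hle

theorem exists_jacobi_solution (hD : 2 * |c| < D) (hd : ∀ j, D ≤ d j) {r : ℤ → ℂ}
    (hr : Summable fun j => ‖r j‖ ^ 2) :
    ∃ q : ℤ → ℂ, Summable (fun j => ‖q j‖ ^ 2) ∧
      ∑' j, ‖q j‖ ^ 2 ≤ (1 / (D - 2 * |c|)) ^ 2 * ∑' j, ‖r j‖ ^ 2 ∧
      ∀ j, d j * q j - c * (q (j + 1) + q (j - 1)) = r j := by
  have hD0 : 0 < D := pos_of_two_mul_abs_lt hD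
  have hd0 (j : ℤ) : 0 < d j := hD0.trans_le (hd j)
  have hle (j : ℤ) : ‖(d j : ℂ)⁻¹ * r j‖ ^ 2 ≤ (1 / D) ^ 2 * ‖r j‖ ^ 2 := by
    rw [norm_mul, mul_pow, norm_inv, Complex.norm_real, Real.norm_of_nonneg (hd0 j).le, ← one_div]
    have := hd0 j
    gcongr
    exact hd j
  have hs : Summable fun j => ‖(d j : ℂ)⁻¹ * r j‖ ^ 2 :=
    (hr.mul_left _).of_nonneg_of_le (fun j => sq_nonneg _) hle
  let ρ : lp (fun _ : ℤ => ℂ) 2 := ⟨fun j => (d j : ℂ)⁻¹ * r j, memℓp_two_iff.2 hs⟩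
  have hρ : ‖ρ‖ ^ 2 ≤ (1 / D) ^ 2 * ∑' j, ‖r j‖ ^ 2 := by
    rw [lp_two_norm_sq, ← tsum_mul_left]
    exact hs.tsum_le_tsum hle (hr.mul_left _)
  obtain ⟨T, hT, hlt, hiff⟩ := exists_jacobi_operator hD hd
  obtain ⟨q, hq⟩ := exists_sub_map_eq (hT.trans_lt hlt) ρ
  refine ⟨q, memℓp_two_iff.1 q.2, ?_, fun j => ?_⟩
  · have hfactor : (1 / (D - 2 * |c|)) ^ 2 = (1 / D) ^ 2 / (1 - |c| / D * 2) ^ 2 := by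
      rw [← div_pow]
      congr 1
      field_simp
    calc ∑' j, ‖q j‖ ^ 2 = ‖q‖ ^ 2 := (lp_two_norm_sq q).symm
      _ ≤ (‖ρ‖ / (1 - |c| / D * 2)) ^ 2 := by
        gcongr
        exact norm_le_div_of_sub_map_eq hT hlt hq
      _ ≤ ((1 / D) ^ 2 * ∑' j, ‖r j‖ ^ 2) / (1 - |c| / D * 2) ^ 2 := by
        rw [div_pow]
        gcongr
      _ = (1 / (D - 2 * |c|)) ^ 2 * ∑' j, ‖r j‖ ^ 2 := by rw [hfactor]; ring
  · rw [(hiff q ρ).1 hq j]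
    exact mul_inv_cancel_left₀ (by exact_mod_cast (hd0 j).ne') _

end DominantDiagonal

theorem eq_zero_of_second_difference_eq_zero {p : ℕ → ℂ}
    (hp : ∀ n, p (n + 2) - p (n + 1) = p (n + 1) - p n) (hlim : Tendsto p atTop (𝓝 0)) : p = 0 := by
  have hdiff (n : ℕ) : p (n + 1) - p n = p 1 - p 0 := by
    induction n with
    | zero => rfl
    | succ n ih => rw [hp n, ih]
  have hslope : p 1 - p 0 = 0 := by
    have hlim' := ((tendsto_add_atTop_iff_nat 1).2 hlim).sub hlim
    simp only [hdiff, sub_zero] at hlim'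
    exact tendsto_nhds_unique tendsto_const_nhds hlim'
  have hconst (n : ℕ) : p n = p 0 := by
    induction n with
    | zero => rfl
    | succ n ih => rw [← ih, ← sub_eq_zero, hdiff, hslope]
  have hzero : p 0 = 0 := by
    rw [funext hconst] at hlim
    exact tendsto_nhds_unique tendsto_const_nhds hlim
  exact funext fun n => (hconst n).trans hzero

theorem eq_zero_of_bandEdge_recursion {c : ℝ} (hc : c ≠ 0) {q : ℕ → ℂ}
    (hq : ∀ n, (2 * |c| : ℝ) * q (n + 1) = c * (q (n + 2) + q n)) (hlim : Tendsto q atTop (𝓝 0)) :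
    q = 0 := by
  obtain ⟨σ, hσ, hcσ⟩ := exists_sq_eq_one_mul_eq_abs c
  have hσC : (σ : ℂ) ^ 2 = 1 := by exact_mod_cast hσ
  have hnorm : |σ| = 1 := by rwa [← sq_eq_sq₀ (abs_nonneg σ) zero_le_one, sq_abs, one_pow]
  have hp : (fun n => (σ : ℂ) ^ n * q n) = 0 := by
    refine eq_zero_of_second_difference_eq_zero (fun n => ?_) ?_
    · have h := hq n
      rw [← hcσ] at h
      push_cast at h
      refine mul_left_cancel₀ (Complex.ofReal_ne_zero.2 hc) ?_
      linear_combination -(σ : ℂ) ^ n * h + (σ : ℂ) ^ n * c * q (n + 2) * hσC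
    · rw [tendsto_zero_iff_norm_tendsto_zero] at hlim ⊢
      simpa [hnorm] using hlim
  funext n
  have hσ0 : (σ : ℂ) ≠ 0 := by
    rintro h
    simp [h] at hσC
  exact (mul_eq_zero.1 (congrFun hp n)).resolve_left (pow_ne_zero n hσ0)

theorem eq_zero_of_jacobi_bandEdge {c : ℝ} {q r : ℤ → ℂ} (hq : Summable fun j => ‖q j‖ ^ 2)
    (hr : ∀ j, j ≠ 0 → j ≠ 1 → r j = 0)
    (h : ∀ j, ((2 * |c| : ℝ) : ℂ) * q j - c * (q (j + 1) + q (j - 1)) = r j) : r 0 = 0 := by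
  rcases eq_or_ne c 0 with rfl | hc
  · simpa using (h 0).symm
  have hlim : Tendsto q cofinite (𝓝 0) := by
    rw [tendsto_zero_iff_norm_tendsto_zero]
    simpa using hq.tendsto_cofinite_zero.sqrt
  have hrec (j : ℤ) (h0 : j ≠ 0) (h1 : j ≠ 1) :
      ((2 * |c| : ℝ) : ℂ) * q j = c * (q (j + 1) + q (j - 1)) :=
    sub_eq_zero.1 ((h j).trans (hr j h0 h1))
  have htail {f : ℕ → ℤ} (hf : f.Injective) : Tendsto (fun n => q (f n)) atTop (𝓝 0) :=
    hlim.comp (Nat.cofinite_eq_atTop ▸ hf.tendsto_cofinite)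
  have hright : (fun n : ℕ => q (n + 1)) = 0 := by
    refine eq_zero_of_bandEdge_recursion hc (fun n => ?_) (htail fun m n hmn => by lia)
    have h := hrec (n + 2) (by lia) (by lia)
    rw [show (n + 2 - 1 : ℤ) = n + 1 by ring, add_right_comm] at h
    simpa [add_assoc, one_add_one_eq_two] using h
  have hleft : (fun n : ℕ => q (-n)) = 0 := by
    refine eq_zero_of_bandEdge_recursion hc (fun n => ?_) (htail fun m n hmn => by lia)
    have h := hrec (-(n + 1)) (by lia) (by lia)
    rw [show (-(n + 1) + 1 : ℤ) = -n by ring, show (-(n + 1) - 1 : ℤ) = -(n + 2) by ring] at h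
    simp only [Nat.cast_add, Nat.cast_one, Nat.cast_ofNat]
    linear_combination h
  have h1 : q 1 = 0 := by simpa using congrFun hright 0
  have h0 : q 0 = 0 := by simpa using congrFun hleft 0
  have hm1 : q (-1) = 0 := by simpa using congrFun hleft 1
  simpa [h0, h1, hm1] using (h 0).symm

/-! ### Absolutely continuous functions -/

theorem absolutelyContinuousOnInterval_of_dist_le {X Y : Type*} [PseudoMetricSpace X]
    [PseudoMetricSpace Y] {f : ℝ → X} {g : ℝ → Y} {a b : ℝ}
    (hg : AbsolutelyContinuousOnInterval g a b)
    (h : ∀ x ∈ Set.uIcc a b, ∀ y ∈ Set.uIcc a b, dist (f x) (f y) ≤ dist (g x) (g y)) :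
    AbsolutelyContinuousOnInterval f a b := by
  rw [absolutelyContinuousOnInterval_iff] at hg ⊢
  intro ε hε
  obtain ⟨δ, hδ, hδε⟩ := hg ε hε
  refine ⟨δ, hδ, fun I hI hlt => (Finset.sum_le_sum fun i hi => ?_).trans_lt (hδε I hI hlt)⟩
  exact h _ (hI.1 i hi).1 _ (hI.1 i hi).2

/-- `f` is absolutely continuous on the interval between `a` and `b`, with derivative `f'`. -/
structure IsPrimitive (a b : ℝ) (f f' : ℝ → ℂ) : Prop where
  intervalIntegrable : IntervalIntegrable f' volume a b
  eq_add_integral : ∀ x ∈ Set.uIcc a b, f x = f a + ∫ t in a..x, f' t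

namespace IsPrimitive

variable {a b x : ℝ} {f f' g g' : ℝ → ℂ}

theorem mono (hf : IsPrimitive a b f f') (hx : x ∈ Set.uIcc a b) : IsPrimitive a x f f' where
  intervalIntegrable := hf.intervalIntegrable.mono_set (Set.uIcc_subset_uIcc_left hx)
  eq_add_integral y hy := hf.eq_add_integral y (Set.uIcc_subset_uIcc_left hx hy)

theorem integral_eq_sub (hf : IsPrimitive a b f f') : ∫ t in a..b, f' t = f b - f a := by
  rw [hf.eq_add_integral b Set.right_mem_uIcc, add_sub_cancel_left]

theorem const (c : ℂ) : IsPrimitive a b (fun _ => c) fun _ => 0 :=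
  ⟨intervalIntegrable_const, fun x _ => by simp⟩

theorem integral (hf : IntervalIntegrable f volume a b) :
    IsPrimitive a b (fun x => ∫ t in a..x, f t) f :=
  ⟨hf, fun x _ => by simp⟩

theorem of_hasDerivAt (hf : ∀ x, HasDerivAt f (f' x) x) (hf' : Continuous f') :
    IsPrimitive a b f f' where
  intervalIntegrable := hf'.intervalIntegrable a b
  eq_add_integral x _ := by
    rw [intervalIntegral.integral_eq_sub_of_hasDerivAt (fun y _ => hf y)
      (hf'.intervalIntegrable a x), add_sub_cancel]

theorem add (hf : IsPrimitive a b f f') (hg : IsPrimitive a b g g') :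
    IsPrimitive a b (fun x => f x + g x) fun x => f' x + g' x where
  intervalIntegrable := hf.intervalIntegrable.add hg.intervalIntegrable
  eq_add_integral x hx := by
    rw [intervalIntegral.integral_add (hf.mono hx).intervalIntegrable
      (hg.mono hx).intervalIntegrable, hf.eq_add_integral x hx, hg.eq_add_integral x hx,
      add_add_add_comm]

theorem const_mul (hf : IsPrimitive a b f f') (c : ℂ) :
    IsPrimitive a b (fun x => c * f x) fun x => c * f' x where
  intervalIntegrable := hf.intervalIntegrable.const_mul c
  eq_add_integral x hx := by
    rw [intervalIntegral.integral_const_mul, hf.eq_add_integral x hx, mul_add]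

theorem absolutelyContinuousOnInterval (hf : IsPrimitive a b f f') :
    AbsolutelyContinuousOnInterval f a b := by
  refine absolutelyContinuousOnInterval_of_dist_le
    (hf.intervalIntegrable.norm.absolutelyContinuousOnInterval_intervalIntegral
      Set.left_mem_uIcc) fun x hx y hy => ?_
  have hintegral {F : Type} [NormedAddCommGroup F] [NormedSpace ℝ F] {k : ℝ → F}
      (hk : IntervalIntegrable k volume a b) :
      (∫ t in a..x, k t) - ∫ t in a..y, k t = ∫ t in y..x, k t :=
    intervalIntegral.integral_interval_sub_left (hk.mono_set (Set.uIcc_subset_uIcc_left hx))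
      (hk.mono_set (Set.uIcc_subset_uIcc_left hy))
  rw [hf.eq_add_integral x hx, hf.eq_add_integral y hy, dist_add_left, dist_eq_norm,
    Real.dist_eq, hintegral hf.intervalIntegrable, hintegral hf.intervalIntegrable.norm]
  exact intervalIntegral.norm_integral_le_abs_integral_norm

theorem continuousOn (hf : IsPrimitive a b f f') : ContinuousOn f (Set.uIcc a b) :=
  hf.absolutelyContinuousOnInterval.continuousOn

theorem mul (hf : IsPrimitive a b f f') (hg : IsPrimitive a b g g') :
    IsPrimitive a b (fun x => f x * g x) fun x => f' x * g x + f x * g' x := by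
  have hint : IntervalIntegrable (fun x => f' x * g x + f x * g' x) volume a b :=
    (hf.intervalIntegrable.mul_continuousOn hg.continuousOn).add
      (hg.intervalIntegrable.continuousOn_mul hf.continuousOn)
  refine ⟨hint, fun x hx => ?_⟩
  have hF := (IsPrimitive.const (f a)).add (.integral hf.intervalIntegrable)
  have hG := (IsPrimitive.const (g a)).add (.integral hg.intervalIntegrable)
  obtain ⟨C, hC⟩ := ((hF.absolutelyContinuousOnInterval.fun_smul
    hG.absolutelyContinuousOnInterval).sub
      (IsPrimitive.integral hint).absolutelyContinuousOnInterval).const_of_ae_hasDerivAt_zero (by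
    filter_upwards [hf.intervalIntegrable.ae_hasDerivAt_integral,
      hg.intervalIntegrable.ae_hasDerivAt_integral, hint.ae_hasDerivAt_integral]
      with y hfy hgy hy hmem
    have hderiv := (((hfy hmem a Set.left_mem_uIcc).const_add (f a)).mul
      ((hgy hmem a Set.left_mem_uIcc).const_add (g a))).sub (hy hmem a Set.left_mem_uIcc)
    rwa [← hf.eq_add_integral y hmem, ← hg.eq_add_integral y hmem, sub_self] at hderiv)
  have hx_eq := hC x hx
  have ha_eq := hC a Set.left_mem_uIcc
  simp only [Pi.sub_apply, smul_eq_mul, intervalIntegral.integral_same, add_zero, sub_zero,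
    ← hf.eq_add_integral x hx, ← hg.eq_add_integral x hx] at hx_eq ha_eq
  rw [ha_eq, ← hx_eq, sub_add_cancel]

end IsPrimitive

theorem HasSobolevDerivs.isPrimitive {a b : ℝ} (hab : a ≤ b) {u v w : ℝ → ℂ}
    (h : HasSobolevDerivs a b u v w) : IsPrimitive a b u v where
  intervalIntegrable := (h.intervalIntegrable (Set.right_mem_Icc.2 hab)).2
  eq_add_integral := Set.uIcc_of_le hab ▸ h.self_eq

theorem HasSobolevDerivs.isPrimitive_deriv {a b : ℝ} (hab : a ≤ b) {u v w : ℝ → ℂ}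
    (h : HasSobolevDerivs a b u v w) : IsPrimitive a b v w where
  intervalIntegrable := (h.intervalIntegrable (Set.right_mem_Icc.2 hab)).1
  eq_add_integral := Set.uIcc_of_le hab ▸ h.deriv_eq

section GreenFormula

variable {a b E : ℝ} {u v w : ℝ → ℂ}

theorem green_formula {κ κ' κ'' : ℝ → ℝ} (hu : IsPrimitive a b u v) (hv : IsPrimitive a b v w)
    (hκ : ∀ t, HasDerivAt κ (κ' t) t) (hκ' : ∀ t, HasDerivAt κ' (κ'' t) t)
    (hκ'' : Continuous κ'') :
    ∫ x in a..b, (κ (x - a) * w x - κ'' (x - a) * u x) =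
      κ (b - a) * v b - κ' (b - a) * u b - (κ 0 * v a - κ' 0 * u a) := by
  have hprim {k k' : ℝ → ℝ} (hk : ∀ t, HasDerivAt k (k' t) t) (hk' : Continuous k') :
      IsPrimitive a b (fun x => (k (x - a) : ℂ)) fun x => (k' (x - a) : ℂ) :=
    .of_hasDerivAt (fun x => ((hk _).comp_sub_const x a).ofReal_comp) (by fun_prop)
  have hcont : Continuous κ' := continuous_iff_continuousAt.2 fun t => (hκ' t).continuousAt
  have hint := (((hprim hκ hcont).mul hv).add
    (((hprim hκ' hκ'').mul hu).const_mul (-1))).integral_eq_sub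
  simp only [sub_self] at hint
  rw [← sub_eq_zero] at hint ⊢
  rw [← hint]
  convert! rfl using 2
  · exact intervalIntegral.integral_congr fun x _ => by ring
  · ring

theorem hasDerivAt_sinE_rev (E l t : ℝ) :
    HasDerivAt (fun t => sinE E (l - t)) (-cosE E (l - t)) t :=
  (hasDerivAt_sinE E (l - t)).comp_const_sub l t

theorem hasDerivAt_neg_cosE_rev (E l t : ℝ) :
    HasDerivAt (fun t => -cosE E (l - t)) (-E * sinE E (l - t)) t := by
  simpa using ((hasDerivAt_cosE E (l - t)).comp_const_sub l t).fun_neg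

theorem variation_of_constants (hu : IsPrimitive a b u v) (hv : IsPrimitive a b v w) :
    u b = cosE E (b - a) * u a + sinE E (b - a) * v a +
      ∫ x in a..b, (sinE E (b - x) : ℂ) * (w x + E * u x) := by
  have hcont : Continuous fun t => -E * sinE E (b - a - t) := by
    have := continuous_sinE E
    fun_prop
  have h := green_formula hu hv (hasDerivAt_sinE_rev E (b - a)) (hasDerivAt_neg_cosE_rev E (b - a))
    hcont
  have hint : ∫ x in a..b, (sinE E (b - x) : ℂ) * (w x + E * u x) = _ :=
    (intervalIntegral.integral_congr fun x _ => by
      simp only [sub_sub_sub_cancel_right]; push_cast; ring).trans h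
  rw [hint]
  simp only [sub_self, sub_zero, sinE_zero, cosE_zero]
  push_cast
  ring

theorem eqOn_zero_of_dirichlet (hS : sinE E (b - a) ≠ 0) (hu : IsPrimitive a b u v)
    (hv : IsPrimitive a b v w) (hw : ∀ᵐ x, x ∈ Set.uIoc a b → w x + E * u x = 0)
    (ha : u a = 0) (hb : u b = 0) : Set.EqOn u 0 (Set.uIcc a b) := by
  have hu_eq (x : ℝ) (hx : x ∈ Set.uIcc a b) : u x = sinE E (x - a) * v a := by
    rw [variation_of_constants (E := E) (hu.mono hx) (hv.mono hx), ha,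
      intervalIntegral.integral_zero_ae]
    · ring
    · filter_upwards [hw] with t ht htx
      rw [ht (Set.uIoc_subset_uIoc_of_uIcc_subset_uIcc (Set.uIcc_subset_uIcc_left hx) htx),
        mul_zero]
  have hva : v a = 0 := by
    have h := hu_eq b Set.right_mem_uIcc
    rw [hb, eq_comm, mul_eq_zero] at h
    exact h.resolve_left (by exact_mod_cast hS)
  exact fun x hx => by rw [hu_eq x hx, hva, mul_zero, Pi.zero_apply]

end GreenFormula

/-! ### The inhomogeneous equation on an edge -/

theorem sq_integral_norm_le {Ω F : Type*} [MeasurableSpace Ω] {μ : Measure Ω} [IsFiniteMeasure μ]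
    [NormedAddCommGroup F] {g : Ω → F} (hg : MemLp g 2 μ) :
    (∫ x, ‖g x‖ ∂μ) ^ 2 ≤ μ.real Set.univ * ∫ x, ‖g x‖ ^ 2 ∂μ := by
  have h := integral_mul_le_Lp_mul_Lq_of_nonneg (p := 2) (q := 2) (f := fun _ => 1)
    Real.HolderConjugate.two_two (.of_forall fun _ => zero_le_one)
    (.of_forall fun x => norm_nonneg (g x)) (memLp_const (μ := μ) 1) (by simpa using hg.norm)
  simp only [one_mul, Real.rpow_two, one_pow, integral_const, smul_eq_mul, mul_one,
    ← Real.sqrt_eq_rpow] at h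
  calc (∫ x, ‖g x‖ ∂μ) ^ 2
      ≤ (√(μ.real Set.univ) * √(∫ x, ‖g x‖ ^ 2 ∂μ)) ^ 2 :=
        pow_le_pow_left₀ (integral_nonneg fun x => norm_nonneg _) h 2
    _ = μ.real Set.univ * ∫ x, ‖g x‖ ^ 2 ∂μ := by
        rw [mul_pow, Real.sq_sqrt measureReal_nonneg,
          Real.sq_sqrt (integral_nonneg fun x => sq_nonneg _)]

theorem norm_integral_mul_le {a b x B : ℝ} {k g : ℝ → ℂ} (hx : x ∈ Set.Icc a b)
    (hk : ∀ t ∈ Set.Icc a b, ‖k t‖ ≤ B) (hg : IntervalIntegrable g volume a b) :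
    ‖∫ t in a..x, k t * g t‖ ≤ B * ∫ t in a..b, ‖g t‖ := by
  have hB : 0 ≤ B := (norm_nonneg _).trans (hk x hx)
  have hint := hg.norm.const_mul B
  rw [← intervalIntegral.integral_const_mul]
  calc ‖∫ t in a..x, k t * g t‖
      ≤ ∫ t in a..x, B * ‖g t‖ := by
        refine intervalIntegral.norm_integral_le_of_norm_le hx.1 (.of_forall fun t ht => ?_)
          (hint.mono_set ?_)
        · rw [norm_mul]
          gcongr
          exact hk t ⟨ht.1.le, ht.2.trans hx.2⟩
        · exact Set.uIcc_subset_uIcc_left (Set.Icc_subset_uIcc hx)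
    _ ≤ ∫ t in a..b, B * ‖g t‖ :=
        intervalIntegral.integral_mono_interval le_rfl hx.1 hx.2
          (.of_forall fun t => by positivity) hint

theorem exists_norm_cosE_sinE_le (E l : ℝ) :
    ∃ B, 0 ≤ B ∧ ∀ t ∈ Set.Icc 0 l, ‖(cosE E t : ℂ)‖ ≤ B ∧ ‖(sinE E t : ℂ)‖ ≤ B := by
  have hcos := continuous_cosE E
  have hsin := continuous_sinE E
  obtain ⟨B, hB⟩ := isCompact_Icc.exists_bound_of_continuousOn (s := Set.Icc 0 l)
    (f := fun t => ((cosE E t : ℂ), (sinE E t : ℂ))) (by fun_prop)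
  refine ⟨max B 0, le_max_right _ _, fun t ht => ?_⟩
  have h := (hB t ht).trans (le_max_left B 0)
  exact ⟨(norm_fst_le _).trans h, (norm_snd_le _).trans h⟩

section Duhamel

variable {E a b B x : ℝ} {g : ℝ → ℂ}

/-- Duhamel's integral: the solution of `-U'' - E U = g` with `U a = U' a = 0`. The kernel
`sinE E (x - t)` is expanded by the addition theorem, which makes the derivative easy to read
off. -/
def duhamel (E a : ℝ) (g : ℝ → ℂ) (x : ℝ) : ℂ :=
  cosE E (x - a) * (∫ t in a..x, sinE E (t - a) * g t) -
    sinE E (x - a) * ∫ t in a..x, cosE E (t - a) * g t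

/-- The derivative of `duhamel E a g`. -/
def duhamelDeriv (E a : ℝ) (g : ℝ → ℂ) (x : ℝ) : ℂ :=
  -E * (sinE E (x - a) * ∫ t in a..x, sinE E (t - a) * g t) -
    cosE E (x - a) * ∫ t in a..x, cosE E (t - a) * g t

theorem isPrimitive_sinE_sub : IsPrimitive a b (fun x => (sinE E (x - a) : ℂ))
    fun x => (cosE E (x - a) : ℂ) := by
  have := continuous_cosE E
  exact .of_hasDerivAt (fun x => ((hasDerivAt_sinE E (x - a)).comp_sub_const x a).ofReal_comp)
    (by fun_prop)

theorem isPrimitive_cosE_sub : IsPrimitive a b (fun x => (cosE E (x - a) : ℂ))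
    fun x => ((-E * sinE E (x - a) : ℝ) : ℂ) := by
  have := continuous_sinE E
  exact .of_hasDerivAt (fun x => ((hasDerivAt_cosE E (x - a)).comp_sub_const x a).ofReal_comp)
    (by fun_prop)

theorem isPrimitive_duhamel (hg : IntervalIntegrable g volume a b) :
    IsPrimitive a b (duhamel E a g) (duhamelDeriv E a g) ∧
      IsPrimitive a b (duhamelDeriv E a g) fun x => -E * duhamel E a g x - g x := by
  have hsin := IsPrimitive.integral (hg.continuousOn_mul
    (isPrimitive_sinE_sub (E := E)).continuousOn)
  have hcos := IsPrimitive.integral (hg.continuousOn_mul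
    (isPrimitive_cosE_sub (E := E)).continuousOn)
  constructor
  · convert! (isPrimitive_cosE_sub.mul hsin).add ((isPrimitive_sinE_sub.mul hcos).const_mul (-1))
      using 2 with x x
    · rw [duhamel]; ring
    · rw [duhamelDeriv]; push_cast; ring
  · convert! ((isPrimitive_sinE_sub.mul hsin).const_mul (-E)).add
      ((isPrimitive_cosE_sub.mul hcos).const_mul (-1)) using 2 with x x
    · rw [duhamelDeriv]; ring
    · have hsq : (cosE E (x - a) : ℂ) ^ 2 + E * (sinE E (x - a) : ℂ) ^ 2 = 1 := by
        exact_mod_cast cosE_sq_add E (x - a)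
      rw [duhamel]
      push_cast
      linear_combination g x * hsq

theorem duhamel_self : duhamel E a g a = 0 := by simp [duhamel]

theorem norm_duhamel_le (hx : x ∈ Set.Icc a b) (hg : IntervalIntegrable g volume a b)
    (hB : ∀ t ∈ Set.Icc 0 (b - a), ‖(cosE E t : ℂ)‖ ≤ B ∧ ‖(sinE E t : ℂ)‖ ≤ B) :
    ‖duhamel E a g x‖ ≤ 2 * B ^ 2 * ∫ t in a..b, ‖g t‖ := by
  have hmem (t : ℝ) (ht : t ∈ Set.Icc a b) : t - a ∈ Set.Icc 0 (b - a) :=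
    ⟨sub_nonneg.2 ht.1, sub_le_sub_right ht.2 a⟩
  have hB0 : 0 ≤ B := (norm_nonneg _).trans (hB _ (hmem x hx)).1
  calc ‖duhamel E a g x‖
      ≤ B * (B * ∫ t in a..b, ‖g t‖) + B * (B * ∫ t in a..b, ‖g t‖) := by
        refine norm_sub_le_of_le ?_ ?_ <;> rw [norm_mul] <;> gcongr
        · exact (hB _ (hmem x hx)).1
        · exact norm_integral_mul_le hx (fun t ht => (hB _ (hmem t ht)).2) hg
        · exact (hB _ (hmem x hx)).2
        · exact norm_integral_mul_le hx (fun t ht => (hB _ (hmem t ht)).1) hg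
    _ = 2 * B ^ 2 * ∫ t in a..b, ‖g t‖ := by ring

end Duhamel

theorem isPrimitive_sinE_rev {E a b : ℝ} : IsPrimitive a b (fun x => (sinE E (b - x) : ℂ))
    fun x => ((-cosE E (b - x) : ℝ) : ℂ) := by
  have := continuous_cosE E
  exact .of_hasDerivAt (fun x => (hasDerivAt_sinE_rev E b x).ofReal_comp) (by fun_prop)

theorem isPrimitive_neg_cosE_rev {E a b : ℝ} :
    IsPrimitive a b (fun x => ((-cosE E (b - x) : ℝ) : ℂ))
      fun x => ((-E * sinE E (b - x) : ℝ) : ℂ) := by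
  have := continuous_sinE E
  exact .of_hasDerivAt (fun x => (hasDerivAt_neg_cosE_rev E b x).ofReal_comp) (by fun_prop)

theorem exists_dirichlet_solution {E l : ℝ} (hS : sinE E l ≠ 0) :
    ∃ M, 0 ≤ M ∧ ∀ a b : ℝ, a ≤ b → b - a = l → ∀ g : ℝ → ℂ, IntervalIntegrable g volume a b →
      ∀ p q : ℂ, ∃ U V : ℝ → ℂ, IsPrimitive a b U V ∧
        IsPrimitive a b V (fun x => -E * U x - g x) ∧ U a = p ∧ U b = q ∧
        ∀ x ∈ Set.Icc a b, ‖U x‖ ≤ M * (‖p‖ + ‖q‖ + ∫ x in a..b, ‖g x‖) := by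
  obtain ⟨B, hB0, hB⟩ := exists_norm_cosE_sinE_le E l
  set S : ℂ := (sinE E l : ℂ)
  have hS' : S ≠ 0 := Complex.ofReal_ne_zero.2 hS
  refine ⟨2 * B ^ 2 + B / ‖S‖ + 2 * B ^ 2 * (B / ‖S‖), by positivity, ?_⟩
  rintro a b hab rfl g hg p q
  obtain ⟨hU, hV⟩ := isPrimitive_duhamel (E := E) hg
  set r := q - duhamel E a g b
  refine ⟨_, _, (hU.add ((isPrimitive_sinE_rev (E := E)).const_mul (p / S))).add
    ((isPrimitive_sinE_sub (E := E)).const_mul (r / S)), ?_, ?_, ?_, fun x hx => ?_⟩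
  · convert! (hV.add (isPrimitive_neg_cosE_rev.const_mul (p / S))).add
      (isPrimitive_cosE_sub.const_mul (r / S)) using 2 with x
    push_cast
    ring
  · rw [duhamel_self, sub_self, sinE_zero]
    simp [S, hS']
  · rw [sub_self, sinE_zero]
    simp [S, hS', r]
  · have hG : 0 ≤ ∫ t in a..b, ‖g t‖ :=
      intervalIntegral.integral_nonneg hab fun t _ => norm_nonneg _
    have hr : ‖r‖ ≤ ‖q‖ + 2 * B ^ 2 * ∫ t in a..b, ‖g t‖ :=
      norm_sub_le_of_le le_rfl (norm_duhamel_le (Set.right_mem_Icc.2 hab) hg hB)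
    calc _ ≤ 2 * B ^ 2 * (∫ t in a..b, ‖g t‖) + ‖p‖ / ‖S‖ * B + ‖r‖ / ‖S‖ * B := by
          refine norm_add_le_of_le (norm_add_le_of_le (norm_duhamel_le hx hg hB) ?_) ?_ <;>
            rw [norm_mul, norm_div] <;> gcongr
          · exact (hB _ ⟨sub_nonneg.2 hx.2, sub_le_sub_left hx.1 b⟩).2
          · exact (hB _ ⟨sub_nonneg.2 hx.1, sub_le_sub_right hx.2 a⟩).2
      _ ≤ 2 * B ^ 2 * (∫ t in a..b, ‖g t‖) + ‖p‖ / ‖S‖ * B +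
            (‖q‖ + 2 * B ^ 2 * ∫ t in a..b, ‖g t‖) / ‖S‖ * B := by gcongr
      _ ≤ _ := by
          rw [← sub_nonneg]
          ring_nf
          positivity

/-! ### Square integrable functions along the edges -/

theorem memLp_of_continuousOn {a b : ℝ} {p : ENNReal} {f : ℝ → ℂ}
    (hf : ContinuousOn f (Set.Icc a b)) : MemLp f p (volume.restrict (Set.Ioo a b)) := by
  obtain ⟨C, hC⟩ := isCompact_Icc.exists_bound_of_continuousOn hf
  exact .of_bound ((hf.mono Set.Ioo_subset_Icc_self).aestronglyMeasurable measurableSet_Ioo) C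
    (ae_restrict_of_forall_mem measurableSet_Ioo fun x hx => hC x (Set.Ioo_subset_Icc_self hx))

theorem memLp_continuous_mul {a b : ℝ} {p : ENNReal} {k f : ℝ → ℂ} (hk : Continuous k)
    (hf : MemLp f p (volume.restrict (Set.Ioo a b))) :
    MemLp (fun x => k x * f x) p (volume.restrict (Set.Ioo a b)) :=
  hf.mul (memLp_of_continuousOn (p := ⊤) hk.continuousOn)

theorem edge_lt (j : ℤ) : (j : ℝ) * Real.pi < (j + 1) * Real.pi := by
  nlinarith [Real.pi_pos]

theorem edge_length (j : ℤ) : ((j : ℝ) + 1) * Real.pi - j * Real.pi = Real.pi := by ring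

theorem measurableSet_edge (j : ℤ) : MeasurableSet (edge j) := measurableSet_Ioo

theorem volume_real_edge (j : ℤ) : volume.real (edge j) = Real.pi := by
  rw [edge, Real.volume_real_Ioo_of_le (edge_lt j).le, edge_length]

instance isFiniteMeasure_restrict_edge (j : ℤ) :
    IsFiniteMeasure ((volume : Measure ℝ).restrict (edge j)) :=
  inferInstanceAs (IsFiniteMeasure ((volume : Measure ℝ).restrict (Set.Ioo _ _)))

theorem setIntegral_edge {F : Type*} [NormedAddCommGroup F] [NormedSpace ℝ F] (j : ℤ)
    (f : ℝ → F) : ∫ x in edge j, f x = ∫ x in (j * Real.pi)..((j + 1) * Real.pi), f x := by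
  rw [intervalIntegral.integral_of_le (edge_lt j).le, integral_Ioc_eq_integral_Ioo, edge]

theorem intervalIntegrable_of_memLp_edge {j : ℤ} {f : ℝ → ℂ}
    (hf : MemLp f 2 (volume.restrict (edge j))) :
    IntervalIntegrable f volume (j * Real.pi) ((j + 1) * Real.pi) :=
  (intervalIntegrable_iff_integrableOn_Ioo_of_le (edge_lt j).le).2 (hf.integrable one_le_two)

theorem floor_eq_of_mem_edge {j : ℤ} {x : ℝ} (hx : x ∈ edge j) : ⌊x / Real.pi⌋ = j := by
  rw [Int.floor_eq_iff, le_div_iff₀ Real.pi_pos, div_lt_iff₀ Real.pi_pos]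
  exact ⟨hx.1.le, hx.2⟩

theorem pairwise_disjoint_edge : Pairwise (Function.onFun Disjoint edge) := fun i j hij =>
  Set.disjoint_left.2 fun x hi hj =>
    hij (by rw [← floor_eq_of_mem_edge hi, floor_eq_of_mem_edge hj])

theorem restrict_iUnion_edge : (volume : Measure ℝ).restrict (⋃ j, edge j) = volume :=
  Measure.restrict_eq_self_of_ae_mem <| ae_of_ae_edge fun j =>
    ae_restrict_of_forall_mem (measurableSet_edge j) fun _ hx => Set.mem_iUnion.2 ⟨j, hx⟩

theorem norm_sq_eq_integral {Ω : Type*} [MeasurableSpace Ω] {μ : Measure Ω} (f : Lp ℂ 2 μ) :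
    ‖f‖ ^ 2 = ∫ x, ‖f x‖ ^ 2 ∂μ := by
  rw [@norm_sq_eq_re_inner ℂ, L2.inner_def, ← integral_re (L2.integrable_inner f f)]
  simp only [← norm_sq_eq_re_inner]

/-- The squared `L²` norm of a function on the `j`-th edge. -/
def edgeNormSq (j : ℤ) (f : ℝ → ℂ) : ℝ := ∫ x in edge j, ‖f x‖ ^ 2

theorem edgeNormSq_nonneg (j : ℤ) (f : ℝ → ℂ) : 0 ≤ edgeNormSq j f :=
  integral_nonneg fun _ => sq_nonneg _

theorem edgeNormSq_congr {j : ℤ} {f g : ℝ → ℂ} (h : f =ᵐ[volume.restrict (edge j)] g) :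
    edgeNormSq j f = edgeNormSq j g :=
  integral_congr_ae <| h.mono fun x hx => by simp only [hx]

theorem hasSum_edgeNormSq (f : Lp ℂ 2 (volume : Measure ℝ)) :
    HasSum (fun j => edgeNormSq j f) (‖f‖ ^ 2) := by
  have h := hasSum_integral_iUnion (μ := volume) measurableSet_edge pairwise_disjoint_edge
    ((memLp_two_iff_integrable_sq_norm (Lp.memLp f).1).1 (Lp.memLp f)).integrableOn
  rwa [restrict_iUnion_edge, ← norm_sq_eq_integral] at h

theorem memLp_edge (f : Lp ℂ 2 (volume : Measure ℝ)) (j : ℤ) :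
    MemLp f 2 (volume.restrict (edge j)) :=
  (Lp.memLp f).restrict _

theorem memLp_of_edge {f : ℝ → ℂ} (hf : ∀ j, MemLp f 2 (volume.restrict (edge j)))
    (hs : Summable fun j => edgeNormSq j f) : MemLp f 2 volume := by
  have hm : AEStronglyMeasurable f volume := by
    rw [← restrict_iUnion_edge, aestronglyMeasurable_iUnion_iff]
    exact fun j => (hf j).1
  rw [memLp_two_iff_integrable_sq_norm hm, ← restrict_iUnion_edge]
  exact integrableOn_iUnion_of_summable_integral_norm
    (fun j => (memLp_two_iff_integrable_sq_norm (hf j).1).1 (hf j))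
    (hs.congr fun j => by simp [edgeNormSq])

theorem exists_Lp_of_edge {u : ℤ → ℝ → ℂ} (hu : ∀ j, MemLp (u j) 2 (volume.restrict (edge j)))
    (hs : Summable fun j => edgeNormSq j (u j)) :
    ∃ f : Lp ℂ 2 (volume : Measure ℝ), ∀ j, f =ᵐ[volume.restrict (edge j)] u j := by
  let g : ℝ → ℂ := fun x => u ⌊x / Real.pi⌋ x
  have hg (j : ℤ) : g =ᵐ[volume.restrict (edge j)] u j :=
    ae_restrict_of_forall_mem (measurableSet_edge j) fun x hx => by
      simp only [g, floor_eq_of_mem_edge hx]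
  have hmem : MemLp g 2 volume := memLp_of_edge (fun j => (memLp_congr_ae (hg j)).2 (hu j))
    (hs.congr fun j => (edgeNormSq_congr (hg j)).symm)
  exact ⟨hmem.toLp, fun j => Filter.EventuallyEq.trans (ae_restrict_of_ae hmem.coeFn_toLp) (hg j)⟩

/-! ### Functions on one edge -/

/-- The factor `e^{c (x - a)}`, which transforms the quasiderivative `d/dx + c` into `d/dx`. It is
normalized to be `1` at `a`, the left endpoint of an edge. -/
def gauge (c : ℂ) (a x : ℝ) : ℂ := Complex.exp (c * (x - a : ℝ))

theorem continuous_gauge (c : ℂ) (a : ℝ) : Continuous (gauge c a) := by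
  unfold gauge
  fun_prop

@[simp] theorem gauge_self (c : ℂ) (a : ℝ) : gauge c a a = 1 := by simp [gauge]

theorem gauge_ne_zero (c : ℂ) (a x : ℝ) : gauge c a x ≠ 0 := Complex.exp_ne_zero _

theorem gauge_neg_mul (c : ℂ) (a x : ℝ) : gauge (-c) a x * gauge c a x = 1 := by
  rw [gauge, gauge, ← Complex.exp_add, neg_mul, neg_add_cancel, Complex.exp_zero]

theorem norm_gauge {c : ℂ} (hc : c.re = 0) (a x : ℝ) : ‖gauge c a x‖ = 1 := by
  rw [gauge, Complex.norm_exp, Complex.re_mul_ofReal, hc, zero_mul, Real.exp_zero]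

theorem coeff_re (A : ℝ) (s : Bool) : (coeff A s).re = 0 := by
  cases s <;> simp [coeff]

theorem hasDerivAt_gauge (c : ℂ) (a x : ℝ) : HasDerivAt (gauge c a) (c * gauge c a x) x := by
  have h : HasDerivAt (fun x : ℝ => c * ((x - a : ℝ) : ℂ)) c x := by
    simpa using ((hasDerivAt_id' x).sub_const a).ofReal_comp.const_mul c
  rw [mul_comm]
  exact h.cexp

namespace IsPrimitive

variable {a b : ℝ} {u v w : ℝ → ℂ}

theorem gauge_mul (c : ℂ) (hu : IsPrimitive a b u v) :
    IsPrimitive a b (fun x => gauge c a x * u x) fun x => gauge c a x * quasiDeriv c u v x := by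
  convert! (IsPrimitive.of_hasDerivAt (hasDerivAt_gauge c a)
    (continuous_const.mul (continuous_gauge c a))).mul hu using 2 with x
  rw [RingChain.quasiDeriv]
  ring

theorem quasiDeriv (c : ℂ) (hu : IsPrimitive a b u v) (hv : IsPrimitive a b v w) :
    IsPrimitive a b (quasiDeriv c u v) (quasiDeriv c v w) :=
  hv.add (hu.const_mul c)

end IsPrimitive

/-- `-𝒟²u` for a function `u` with first and second derivatives `v` and `w`, where
`𝒟 = d/dx + c`. -/
def magLap (c : ℂ) (u v w : ℝ → ℂ) (x : ℝ) : ℂ :=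
  -quasiDeriv c (quasiDeriv c u v) (quasiDeriv c v w) x

/-- `u`, with first and second derivatives `v` and `w`, is a solution of `-𝒟²u - E u = f` on the
edge `(s, j)`. -/
structure IsEdgeSolution (A E : ℝ) (s : Bool) (j : ℤ) (f u v w : ℝ → ℂ) : Prop where
  sobolev : HasSobolevDerivs (j * Real.pi) ((j + 1) * Real.pi) u v w
  ae_eq : ∀ᵐ x ∂(volume.restrict (edge j)), f x = magLap (coeff A s) u v w x - E * u x

/-- The integral of `f` over the edge `(s, j)` against the profile `κ`, in the gauge of that
edge; the argument of `κ` is the distance from the left endpoint. -/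
def edgeInt (A : ℝ) (s : Bool) (κ : ℝ → ℝ) (j : ℤ) (f : ℝ → ℂ) : ℂ :=
  ∫ x in edge j, κ (x - j * Real.pi) * (gauge (coeff A s) (j * Real.pi) x * f x)

/-- The phase that is accumulated along a semicircle. -/
def phase (A : ℝ) (s : Bool) : ℂ := Complex.exp (coeff A s * Real.pi)

theorem gauge_right (A : ℝ) (s : Bool) (j : ℤ) :
    gauge (coeff A s) (j * Real.pi) ((j + 1) * Real.pi) = phase A s := by
  rw [gauge, edge_length, phase]

theorem phase_ne_zero (A : ℝ) (s : Bool) : phase A s ≠ 0 := Complex.exp_ne_zero _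

theorem norm_phase (A : ℝ) (s : Bool) : ‖phase A s‖ = 1 := by
  rw [← gauge_right A s 0, norm_gauge (coeff_re A s)]

theorem sum_phase (A : ℝ) : ∑ s, phase A s = (2 * Real.cos (A * Real.pi) : ℝ) := by
  push_cast
  rw [Complex.cos, Fintype.sum_bool, phase, phase]
  simp only [coeff, if_true, Bool.false_eq_true, if_false]
  ring_nf

theorem sum_inv_phase (A : ℝ) : ∑ s, (phase A s)⁻¹ = (2 * Real.cos (A * Real.pi) : ℝ) := by
  rw [← sum_phase, Fintype.sum_bool, Fintype.sum_bool, add_comm, phase, phase, ← Complex.exp_neg,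
    ← Complex.exp_neg]
  simp [coeff]

section EdgeInt

variable {A : ℝ} {s : Bool} {κ : ℝ → ℝ} {j : ℤ} {f g : ℝ → ℂ}

theorem edgeInt_congr (h : f =ᵐ[volume.restrict (edge j)] g) :
    edgeInt A s κ j f = edgeInt A s κ j g :=
  integral_congr_ae <| h.mono fun x hx => by simp only [hx]

theorem integrable_edgeInt (hκ : Continuous κ) (hf : MemLp f 2 (volume.restrict (edge j))) :
    Integrable (fun x => κ (x - j * Real.pi) * (gauge (coeff A s) (j * Real.pi) x * f x))
      (volume.restrict (edge j)) :=
  (memLp_continuous_mul (k := fun x => (κ (x - j * Real.pi) : ℂ)) (by fun_prop)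
    (memLp_continuous_mul (continuous_gauge _ _) hf)).integrable one_le_two

theorem exists_norm_edgeInt_sq_le (hκ : Continuous κ) : ∃ K, 0 ≤ K ∧ ∀ A s j f,
    MemLp f 2 (volume.restrict (edge j)) → ‖edgeInt A s κ j f‖ ^ 2 ≤ K * edgeNormSq j f := by
  obtain ⟨B, hB⟩ := isCompact_Icc.exists_bound_of_continuousOn (s := Set.Icc 0 Real.pi)
    hκ.continuousOn
  refine ⟨B ^ 2 * Real.pi, by positivity, fun A s j f hf => ?_⟩
  have hle : ‖edgeInt A s κ j f‖ ≤ B * ∫ x in edge j, ‖f x‖ := by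
    rw [← integral_const_mul]
    refine norm_integral_le_of_norm_le ((hf.integrable one_le_two).norm.const_mul B)
      (ae_restrict_of_forall_mem (measurableSet_edge j) fun x hx => ?_)
    rw [norm_mul, norm_mul, norm_gauge (coeff_re A s), one_mul, Complex.norm_real]
    gcongr
    exact hB _ ⟨by linarith [hx.1], by linarith [hx.2]⟩
  calc ‖edgeInt A s κ j f‖ ^ 2 ≤ (B * ∫ x in edge j, ‖f x‖) ^ 2 := by gcongr
    _ = B ^ 2 * (∫ x in edge j, ‖f x‖) ^ 2 := mul_pow _ _ _
    _ ≤ B ^ 2 * (Real.pi * edgeNormSq j f) := by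
        gcongr
        simpa [volume_real_edge, edgeNormSq] using sq_integral_norm_le hf
    _ = B ^ 2 * Real.pi * edgeNormSq j f := (mul_assoc _ _ _).symm

/-- `edgeInt` as a linear functional on `L²(ℝ)`. -/
def edgeFunctional (A : ℝ) (s : Bool) (hκ : Continuous κ) (j : ℤ) :
    Lp ℂ 2 (volume : Measure ℝ) →ₗ[ℂ] ℂ where
  toFun f := edgeInt A s κ j f
  map_add' f g := by
    rw [edgeInt_congr (ae_restrict_of_ae (Lp.coeFn_add f g)), edgeInt, edgeInt, edgeInt,
      ← integral_add (integrable_edgeInt hκ (memLp_edge f j))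
        (integrable_edgeInt hκ (memLp_edge g j))]
    simp only [Pi.add_apply, mul_add]
  map_smul' c f := by
    rw [edgeInt_congr (ae_restrict_of_ae (Lp.coeFn_smul c f)), edgeInt, edgeInt, RingHom.id_apply,
      smul_eq_mul, ← integral_const_mul]
    simp only [Pi.smul_apply, smul_eq_mul, mul_left_comm]

end EdgeInt

theorem HasSobolevDerivs.memLp_edge {j : ℤ} {u v w : ℝ → ℂ}
    (h : HasSobolevDerivs (j * Real.pi) ((j + 1) * Real.pi) u v w) :
    MemLp u 2 (volume.restrict (edge j)) :=
  memLp_of_continuousOn (h.continuousOn (edge_lt j).le)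

namespace IsEdgeSolution

variable {A E : ℝ} {s : Bool} {j : ℤ} {f u v w : ℝ → ℂ}

theorem memLp (h : IsEdgeSolution A E s j f u v w) : MemLp f 2 (volume.restrict (edge j)) := by
  have hu := h.sobolev.memLp_edge
  have hv : MemLp v 2 (volume.restrict (edge j)) :=
    memLp_of_continuousOn (h.sobolev.continuousOn_deriv (edge_lt j).le)
  exact (memLp_congr_ae h.ae_eq).2 (((h.sobolev.memLp.add (hv.const_mul _)).add
    ((hv.add (hu.const_mul _)).const_mul _)).neg.sub (hu.const_mul _))

theorem isPrimitive_gauge (h : IsEdgeSolution A E s j f u v w) :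
    IsPrimitive (j * Real.pi) ((j + 1) * Real.pi)
        (fun x => gauge (coeff A s) (j * Real.pi) x * u x)
        (fun x => gauge (coeff A s) (j * Real.pi) x * quasiDeriv (coeff A s) u v x) ∧
      IsPrimitive (j * Real.pi) ((j + 1) * Real.pi)
        (fun x => gauge (coeff A s) (j * Real.pi) x * quasiDeriv (coeff A s) u v x)
        (fun x => -(gauge (coeff A s) (j * Real.pi) x * magLap (coeff A s) u v w x)) := by
  have hu := h.sobolev.isPrimitive (edge_lt j).le
  refine ⟨hu.gauge_mul _, ?_⟩
  simpa only [magLap, mul_neg, neg_neg] using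
    (hu.quasiDeriv _ (h.sobolev.isPrimitive_deriv (edge_lt j).le)).gauge_mul _

theorem green_formula {κ κ' κ'' : ℝ → ℝ} (h : IsEdgeSolution A E s j f u v w)
    (hκ : ∀ t, HasDerivAt κ (κ' t) t) (hκ' : ∀ t, HasDerivAt κ' (κ'' t) t)
    (hκ'' : Continuous κ'') :
    edgeInt A s κ j f + edgeInt A s (fun t => κ'' t + E * κ t) j u =
      κ 0 * quasiDeriv (coeff A s) u v (j * Real.pi) - κ' 0 * u (j * Real.pi) -
        phase A s * (κ Real.pi * quasiDeriv (coeff A s) u v ((j + 1) * Real.pi) -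
          κ' Real.pi * u ((j + 1) * Real.pi)) := by
  have hcont : Continuous κ := continuous_iff_continuousAt.2 fun t => (hκ t).continuousAt
  have hgreen := RingChain.green_formula h.isPrimitive_gauge.1 h.isPrimitive_gauge.2 hκ hκ' hκ''
  rw [edge_length, gauge_self, gauge_right, ← setIntegral_edge] at hgreen
  have hsum := integral_add (integrable_edgeInt (A := A) (s := s) hcont h.memLp)
    (integrable_edgeInt (A := A) (s := s) (κ := fun t => κ'' t + E * κ t) (by fun_prop)
      h.sobolev.memLp_edge)
  calc edgeInt A s κ j f + edgeInt A s (fun t => κ'' t + E * κ t) j u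
      = ∫ x in edge j, -(κ (x - j * Real.pi) *
          -(gauge (coeff A s) (j * Real.pi) x * magLap (coeff A s) u v w x) -
            κ'' (x - j * Real.pi) * (gauge (coeff A s) (j * Real.pi) x * u x)) := by
        rw [edgeInt, edgeInt, ← hsum]
        refine integral_congr_ae (h.ae_eq.mono fun x hx => ?_)
        simp only [hx]
        push_cast
        ring
    _ = _ := by
        rw [integral_neg, hgreen]
        ring

theorem flux_left (h : IsEdgeSolution A E s j f u v w) :
    sinE E Real.pi * quasiDeriv (coeff A s) u v (j * Real.pi) =
      phase A s * u ((j + 1) * Real.pi) - cosE E Real.pi * u (j * Real.pi) +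
        edgeInt A s (fun t => sinE E (Real.pi - t)) j f := by
  have := continuous_sinE E
  have hgreen := h.green_formula (hasDerivAt_sinE_rev E Real.pi)
    (hasDerivAt_neg_cosE_rev E Real.pi) (by fun_prop)
  simp only [edgeInt, neg_mul, neg_add_cancel, Complex.ofReal_zero, zero_mul, integral_zero,
    add_zero, sub_zero, Complex.ofReal_neg, sub_neg_eq_add, sub_self, sinE_zero, cosE_zero,
    Complex.ofReal_one, one_mul, zero_add] at hgreen ⊢
  rw [hgreen]
  ring

theorem flux_right (h : IsEdgeSolution A E s j f u v w) :
    sinE E Real.pi * quasiDeriv (coeff A s) u v ((j + 1) * Real.pi) =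
      cosE E Real.pi * u ((j + 1) * Real.pi) - (phase A s)⁻¹ * u (j * Real.pi) -
        (phase A s)⁻¹ * edgeInt A s (sinE E) j f := by
  have := continuous_sinE E
  have hgreen := h.green_formula (hasDerivAt_sinE E) (hasDerivAt_cosE E) (by fun_prop)
  have hphase := phase_ne_zero A s
  simp only [edgeInt, neg_mul, neg_add_cancel, Complex.ofReal_zero, zero_mul, integral_zero,
    add_zero, sinE_zero, cosE_zero, Complex.ofReal_one, one_mul, zero_sub] at hgreen ⊢
  rw [hgreen]
  field_simp
  ring

end IsEdgeSolution

/-- A cubic profile with slope `1` at `0` and a double zero at `π`: pairing with it singles out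
the boundary value at the left endpoint of an edge. -/
def traceProfile (t : ℝ) : ℝ := t * (Real.pi - t) ^ 2 / Real.pi ^ 2

/-- The second derivative of `traceProfile`. -/
def traceProfile'' (t : ℝ) : ℝ := (6 * t - 4 * Real.pi) / Real.pi ^ 2

theorem continuous_traceProfile : Continuous traceProfile := by
  unfold traceProfile
  fun_prop

theorem continuous_traceProfile'' : Continuous traceProfile'' := by
  unfold traceProfile''
  fun_prop

theorem IsEdgeSolution.trace_left {A : ℝ} {s : Bool} {j : ℤ} {f u v w : ℝ → ℂ}
    (h : IsEdgeSolution A 0 s j f u v w) :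
    u (j * Real.pi) = -edgeInt A s traceProfile j f - edgeInt A s traceProfile'' j u := by
  let κ' : ℝ → ℝ := fun t => (Real.pi - t) * (Real.pi - 3 * t) / Real.pi ^ 2
  have hκ (t : ℝ) : HasDerivAt traceProfile (κ' t) t := by
    convert! ((hasDerivAt_id' t).mul (((hasDerivAt_id' t).const_sub Real.pi).pow 2)).div_const
      (Real.pi ^ 2) using 1
    simp only [κ', Pi.pow_apply, Nat.cast_ofNat]
    ring
  have hκ' (t : ℝ) : HasDerivAt κ' (traceProfile'' t) t := by
    convert! (((hasDerivAt_id' t).const_sub Real.pi).mul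
      (((hasDerivAt_id' t).const_mul 3).const_sub Real.pi)).div_const (Real.pi ^ 2) using 1
    simp only [traceProfile'']
    ring
  have hgreen := h.green_formula hκ hκ' continuous_traceProfile''
  simp only [traceProfile, κ', zero_mul, add_zero, mul_zero, sub_zero, sub_self, zero_div,
    Complex.ofReal_zero, zero_sub, zero_pow two_ne_zero, ← sq,
    div_self (pow_ne_zero 2 Real.pi_ne_zero), Complex.ofReal_one, one_mul] at hgreen
  rw [← neg_eq_iff_eq_neg.2 hgreen]
  unfold traceProfile
  ring

/-! ### The Jacobi equation for the vertex values -/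

/-- The right-hand side of the Jacobi equation that is satisfied by the vertex values of a solution
of `-𝒟²u - E u = f` on the chain. -/
def source (A E : ℝ) (f : Bool → ℝ → ℂ) (j : ℤ) : ℂ :=
  ∑ s, (edgeInt A s (fun t => sinE E (Real.pi - t)) j (f s) +
    (phase A s)⁻¹ * edgeInt A s (sinE E) (j - 1) (f s))

theorem vertex_identity {A E : ℝ} {f : Bool → ℝ → ℂ} {u v w : Bool → ℤ → ℝ → ℂ} {q : ℤ → ℂ}
    (h : ∀ s j, IsEdgeSolution A E s j (f s) (u s j) (v s j) (w s j))
    (hl : ∀ s j, u s j (j * Real.pi) = q j) (hr : ∀ s j, u s j ((j + 1) * Real.pi) = q (j + 1))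
    (j : ℤ) :
    sinE E Real.pi * ∑ s, (quasiDeriv (coeff A s) (u s j) (v s j) (j * Real.pi) -
        quasiDeriv (coeff A s) (u s (j - 1)) (v s (j - 1)) (j * Real.pi)) =
      (2 * Real.cos (A * Real.pi) : ℝ) * (q (j + 1) + q (j - 1)) - 4 * cosE E Real.pi * q j +
        source A E f j := by
  have hflux (s : Bool) : sinE E Real.pi * (quasiDeriv (coeff A s) (u s j) (v s j) (j * Real.pi) -
      quasiDeriv (coeff A s) (u s (j - 1)) (v s (j - 1)) (j * Real.pi)) =
      phase A s * q (j + 1) + (phase A s)⁻¹ * q (j - 1) - 2 * cosE E Real.pi * q j +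
        (edgeInt A s (fun t => sinE E (Real.pi - t)) j (f s) +
          (phase A s)⁻¹ * edgeInt A s (sinE E) (j - 1) (f s)) := by
    have hleft := (h s j).flux_left
    have hright := (h s (j - 1)).flux_right
    rw [hl, hr] at hleft hright
    rw [sub_add_cancel, Int.cast_sub, Int.cast_one, sub_add_cancel] at hright
    linear_combination hleft - hright
  rw [Finset.mul_sum, Finset.sum_congr rfl fun s _ => hflux s, Finset.sum_add_distrib, source]
  rw [Finset.sum_sub_distrib, Finset.sum_add_distrib, ← Finset.sum_mul, ← Finset.sum_mul,
    sum_phase, sum_inv_phase, Finset.sum_const, Finset.card_univ, Fintype.card_bool, nsmul_eq_mul]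
  push_cast
  ring

namespace IsWaveFunction

variable {A E : ℝ} {β : ℤ → ℝ} {ψ η : L2Chain} {u v w : Bool → ℤ → ℝ → ℂ}

theorem left_value (h : IsWaveFunction A β ψ η u v w) (s : Bool) (j : ℤ) :
    u s j (j * Real.pi) = u true j (j * Real.pi) := by
  cases s
  exacts [h.cont_lower j, rfl]

theorem right_value (h : IsWaveFunction A β ψ η u v w) (s : Bool) (j : ℤ) :
    u s j ((j + 1) * Real.pi) = u true (j + 1) ((j + 1 : ℤ) * Real.pi) := by
  have hleft := h.cont_left s (j + 1)
  rw [add_sub_cancel_right] at hleft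
  rw [← hleft, Int.cast_add, Int.cast_one]

theorem isEdgeSolution (h : IsWaveFunction A β ψ η u v w) (E : ℝ) (s : Bool) (j : ℤ) :
    IsEdgeSolution A E s j ((η - (E : ℂ) • ψ) s) (u s j) (v s j) (w s j) where
  sobolev := h.sobolev s j
  ae_eq := by
    filter_upwards [h.ae_eq s j, h.action s j,
      ae_restrict_of_ae (Lp.coeFn_sub (η s) ((E : ℂ) • ψ s)),
      ae_restrict_of_ae (Lp.coeFn_smul (E : ℂ) (ψ s))] with x hψ hη hsub hsmul
    rw [PiLp.sub_apply, PiLp.smul_apply, hsub, Pi.sub_apply, hsmul, Pi.smul_apply, hψ, hη]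
    rfl

theorem jacobi (h : IsWaveFunction A β ψ η u v w) (E : ℝ) (j : ℤ) :
    disc (β j) E * u true j (j * Real.pi) - (2 * Real.cos (A * Real.pi) : ℝ) *
      (u true (j + 1) ((j + 1 : ℤ) * Real.pi) + u true (j - 1) ((j - 1 : ℤ) * Real.pi)) =
      source A E (fun s => (η - (E : ℂ) • ψ) s) j := by
  have hvertex := vertex_identity (h.isEdgeSolution E) h.left_value h.right_value j
  have hdelta := h.delta j
  rw [Fintype.sum_bool] at hvertex
  rw [disc]
  push_cast at hvertex ⊢
  linear_combination hvertex - sinE E Real.pi * hdelta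

theorem eq_zero (h : IsWaveFunction A β ψ ((E : ℂ) • ψ) u v w) (hS : sinE E Real.pi ≠ 0)
    (hq : ∀ j : ℤ, u true j (j * Real.pi) = 0) : ψ = 0 := by
  ext s
  refine ae_of_ae_edge fun j => ?_
  have hsol := h.isEdgeSolution E s j
  have hzero := ae_restrict_of_ae (s := edge j) (Lp.coeFn_zero ℂ 2 (volume : Measure ℝ))
  rw [sub_self] at hsol
  have hode : ∀ᵐ x ∂(volume.restrict (edge j)),
      -(gauge (coeff A s) (j * Real.pi) x * magLap (coeff A s) (u s j) (v s j) (w s j) x) +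
        E * (gauge (coeff A s) (j * Real.pi) x * u s j x) = 0 := by
    filter_upwards [hsol.ae_eq, hzero] with x hx hx0
    have hx' : (0 : ℂ) = _ := hx0.symm.trans hx
    linear_combination gauge (coeff A s) (j * Real.pi) x * hx'
  rw [edge, restrict_Ioo_eq_restrict_Ioc, ae_restrict_iff' measurableSet_Ioc,
    ← Set.uIoc_of_le (edge_lt j).le] at hode
  have hgauge := eqOn_zero_of_dirichlet (by rwa [edge_length]) hsol.isPrimitive_gauge.1
    hsol.isPrimitive_gauge.2 hode (by rw [h.left_value, hq, mul_zero])
    (by rw [h.right_value, hq, mul_zero])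
  filter_upwards [h.ae_eq s j, hzero, ae_restrict_mem (measurableSet_edge j)] with x hψ hx0 hx
  refine (hψ.trans ?_).trans hx0.symm
  have hx' := Set.Ioo_subset_Icc_self hx
  rw [← Set.uIcc_of_le (edge_lt j).le] at hx'
  exact (mul_eq_zero.1 (hgauge hx')).resolve_left (gauge_ne_zero _ _ _)

end IsWaveFunction

/-- The value at the vertex `jπ`, as a linear functional of a wave function and its image under
the Hamiltonian. -/
def traceMap (A : ℝ) (j : ℤ) : L2Chain × L2Chain →ₗ[ℂ] ℂ :=
  -(edgeFunctional A true continuous_traceProfile j ∘ₗ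
      PiLp.projₗ 2 (fun _ : Bool => Lp ℂ 2 (volume : Measure ℝ)) true ∘ₗ LinearMap.snd ℂ _ _) -
    edgeFunctional A true continuous_traceProfile'' j ∘ₗ
      PiLp.projₗ 2 (fun _ : Bool => Lp ℂ 2 (volume : Measure ℝ)) true ∘ₗ LinearMap.fst ℂ _ _

theorem traceMap_apply (A : ℝ) (j : ℤ) (p : L2Chain × L2Chain) :
    traceMap A j p =
      -edgeInt A true traceProfile j (p.2 true) - edgeInt A true traceProfile'' j (p.1 true) :=
  rfl

theorem IsWaveFunction.trace {A : ℝ} {β : ℤ → ℝ} {ψ η : L2Chain} {u v w : Bool → ℤ → ℝ → ℂ}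
    (h : IsWaveFunction A β ψ η u v w) (j : ℤ) :
    u true j (j * Real.pi) = traceMap A j (ψ, η) := by
  have hsol := h.isEdgeSolution 0 true j
  rw [Complex.ofReal_zero, zero_smul, sub_zero] at hsol
  rw [hsol.trace_left, traceMap_apply, edgeInt_congr (h.ae_eq true j)]

theorem summable_norm_traceMap_sq (A : ℝ) (p : L2Chain × L2Chain) :
    Summable fun j => ‖traceMap A j p‖ ^ 2 := by
  obtain ⟨K, -, hK⟩ := exists_norm_edgeInt_sq_le continuous_traceProfile
  obtain ⟨K'', -, hK''⟩ := exists_norm_edgeInt_sq_le continuous_traceProfile''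
  refine .of_nonneg_of_le (fun j => sq_nonneg _) (fun j => ?_)
    ((((hasSum_edgeNormSq (p.2 true)).summable.mul_left K).add
      ((hasSum_edgeNormSq (p.1 true)).summable.mul_left K'')).mul_left 2)
  calc ‖traceMap A j p‖ ^ 2
      ≤ (‖edgeInt A true traceProfile j (p.2 true)‖ +
          ‖edgeInt A true traceProfile'' j (p.1 true)‖) ^ 2 := by
        rw [traceMap_apply, ← norm_neg (edgeInt A true traceProfile j _)]
        gcongr
        exact norm_sub_le _ _
    _ ≤ 2 * (‖edgeInt A true traceProfile j (p.2 true)‖ ^ 2 +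
          ‖edgeInt A true traceProfile'' j (p.1 true)‖ ^ 2) := add_sq_le
    _ ≤ 2 * (K * edgeNormSq j (p.2 true) + K'' * edgeNormSq j (p.1 true)) := by
        gcongr
        exacts [hK A true j _ (memLp_edge _ j), hK'' A true j _ (memLp_edge _ j)]

theorem exists_source_bound (E : ℝ) : ∃ K, 0 ≤ K ∧ ∀ (A : ℝ) (f : L2Chain),
    (Summable fun j => ‖source A E (fun s => f s) j‖ ^ 2) ∧
      ∑' j, ‖source A E (fun s => f s) j‖ ^ 2 ≤ K * ‖f‖ ^ 2 := by
  have hcont := continuous_sinE E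
  obtain ⟨K, hK₀, hK⟩ := exists_norm_edgeInt_sq_le
    (show Continuous fun t => sinE E (Real.pi - t) by fun_prop)
  obtain ⟨K', hK₀', hK'⟩ := exists_norm_edgeInt_sq_le hcont
  refine ⟨4 * (K + K'), by positivity, fun A f => ?_⟩
  have hsum : HasSum (fun j => 4 * ∑ s, (K * edgeNormSq j (f s) + K' * edgeNormSq (j - 1) (f s)))
      (4 * ∑ s, (K * ‖f s‖ ^ 2 + K' * ‖f s‖ ^ 2)) :=
    .mul_left 4 <| hasSum_sum fun s _ => ((hasSum_edgeNormSq (f s)).mul_left K).add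
      (((Equiv.subRight (1 : ℤ)).hasSum_iff.2 (hasSum_edgeNormSq (f s))).mul_left K')
  have hle (j : ℤ) : ‖source A E (fun s => f s) j‖ ^ 2 ≤
      4 * ∑ s, (K * edgeNormSq j (f s) + K' * edgeNormSq (j - 1) (f s)) := by
    have hterm (s : Bool) : ‖edgeInt A s (fun t => sinE E (Real.pi - t)) j (f s) +
        (phase A s)⁻¹ * edgeInt A s (sinE E) (j - 1) (f s)‖ ^ 2 ≤
        2 * (K * edgeNormSq j (f s) + K' * edgeNormSq (j - 1) (f s)) := by
      refine (pow_le_pow_left₀ (norm_nonneg _) (norm_add_le _ _) 2).trans (add_sq_le.trans ?_)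
      rw [norm_mul, norm_inv, norm_phase, inv_one, one_mul]
      gcongr
      exacts [hK A s j _ (memLp_edge _ j), hK' A s (j - 1) _ (memLp_edge _ _)]
    rw [source, Fintype.sum_bool, Fintype.sum_bool]
    refine (pow_le_pow_left₀ (norm_nonneg _) (norm_add_le _ _) 2).trans (add_sq_le.trans ?_)
    linarith [hterm true, hterm false]
  have hsummable := hsum.summable.of_nonneg_of_le (fun j => sq_nonneg _) hle
  refine ⟨hsummable, (hsummable.tsum_le_tsum hle hsum.summable).trans_eq ?_⟩
  rw [hsum.tsum_eq, PiLp.norm_sq_eq_of_L2, Finset.sum_congr rfl fun s _ => (add_mul K K' _).symm,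
    ← Finset.mul_sum, mul_assoc]

theorem IsEdgeSolution.of_gauge {A E : ℝ} {s : Bool} {j : ℤ} {f U V : ℝ → ℂ}
    (hf : MemLp f 2 (volume.restrict (edge j)))
    (hU : IsPrimitive (j * Real.pi) ((j + 1) * Real.pi) U V)
    (hV : IsPrimitive (j * Real.pi) ((j + 1) * Real.pi) V
      fun x => -E * U x - gauge (coeff A s) (j * Real.pi) x * f x) :
    ∃ v w, IsEdgeSolution A E s j f (fun x => gauge (-coeff A s) (j * Real.pi) x * U x) v w := by
  have hu := hU.gauge_mul (-coeff A s)
  have hv := (hU.quasiDeriv (-coeff A s) hV).gauge_mul (-coeff A s)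
  have hmemU : MemLp U 2 (volume.restrict (edge j)) := memLp_of_continuousOn <| by
    simpa only [Set.uIcc_of_le (edge_lt j).le] using hU.continuousOn
  have hmemV : MemLp V 2 (volume.restrict (edge j)) := memLp_of_continuousOn <| by
    simpa only [Set.uIcc_of_le (edge_lt j).le] using hV.continuousOn
  have hmemW : MemLp (fun x => -(E : ℂ) * U x - gauge (coeff A s) (j * Real.pi) x * f x) 2
      (volume.restrict (edge j)) :=
    (hmemU.const_mul _).sub (memLp_continuous_mul (continuous_gauge _ _) hf)
  refine ⟨_, _, ⟨?_, fun x hx => hv.eq_add_integral x (Set.Icc_subset_uIcc hx),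
    fun x hx => hu.eq_add_integral x (Set.Icc_subset_uIcc hx)⟩, .of_forall fun x => ?_⟩
  · exact memLp_continuous_mul (continuous_gauge _ _)
      ((hmemW.add (hmemV.const_mul _)).add ((hmemV.add (hmemU.const_mul _)).const_mul _))
  · simp only [magLap, quasiDeriv]
    linear_combination -f x * gauge_neg_mul (coeff A s) (j * Real.pi) x

theorem edgeNormSq_le_of_norm_sq_le {j : ℤ} {f : ℝ → ℂ} {C : ℝ}
    (hf : MemLp f 2 (volume.restrict (edge j))) (hC : ∀ x ∈ edge j, ‖f x‖ ^ 2 ≤ C) :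
    edgeNormSq j f ≤ Real.pi * C :=
  calc edgeNormSq j f ≤ ∫ _ in edge j, C :=
        setIntegral_mono_on ((memLp_two_iff_integrable_sq_norm hf.1).1 hf) (integrable_const _)
          (measurableSet_edge j) hC
    _ = Real.pi * C := by rw [setIntegral_const, volume_real_edge, smul_eq_mul]

theorem add_add_sq_le (a b c : ℝ) : (a + b + c) ^ 2 ≤ 3 * (a ^ 2 + b ^ 2 + c ^ 2) := by
  nlinarith [sq_nonneg (a - b), sq_nonneg (b - c), sq_nonneg (a - c)]

theorem exists_isEdgeSolution {E : ℝ} (hS : sinE E Real.pi ≠ 0) :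
    ∃ M, 0 ≤ M ∧ ∀ (A : ℝ) (s : Bool) (j : ℤ) (f : ℝ → ℂ),
      MemLp f 2 (volume.restrict (edge j)) → ∀ p q : ℂ, ∃ u v w : ℝ → ℂ,
        IsEdgeSolution A E s j f u v w ∧ u (j * Real.pi) = p ∧ u ((j + 1) * Real.pi) = q ∧
          edgeNormSq j u ≤ M * (‖p‖ ^ 2 + ‖q‖ ^ 2 + edgeNormSq j f) := by
  obtain ⟨M, -, hsolve⟩ := exists_dirichlet_solution hS
  refine ⟨Real.pi * (M ^ 2 * (3 * Real.pi)), by positivity, fun A s j f hf p q => ?_⟩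
  obtain ⟨U, V, hU, hV, hleft, hright, hbound⟩ := hsolve _ _ (edge_lt j).le (edge_length j) _
    (intervalIntegrable_of_memLp_edge (memLp_continuous_mul (continuous_gauge (coeff A s)
      (j * Real.pi)) hf)) p (gauge (coeff A s) (j * Real.pi) ((j + 1) * Real.pi) * q)
  obtain ⟨v, w, hsol⟩ := IsEdgeSolution.of_gauge hf hU hV
  refine ⟨_, v, w, hsol, by simp [hleft], by simp only [hright, ← mul_assoc, gauge_neg_mul,
    one_mul], ?_⟩
  rw [mul_assoc]
  refine edgeNormSq_le_of_norm_sq_le hsol.sobolev.memLp_edge fun x hx => ?_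
  have hUx := hbound x (Set.Ioo_subset_Icc_self hx)
  rw [← setIntegral_edge] at hUx
  simp only [norm_mul, norm_gauge (coeff_re A s), one_mul] at hUx
  have hpi : 1 ≤ Real.pi := by linarith [Real.pi_gt_three]
  calc ‖gauge (-coeff A s) (j * Real.pi) x * U x‖ ^ 2 = ‖U x‖ ^ 2 := by
        rw [norm_mul, norm_gauge (by rw [Complex.neg_re, coeff_re, neg_zero]), one_mul]
    _ ≤ (M * (‖p‖ + ‖q‖ + ∫ x in edge j, ‖f x‖)) ^ 2 := by gcongr
    _ = M ^ 2 * (‖p‖ + ‖q‖ + ∫ x in edge j, ‖f x‖) ^ 2 := mul_pow _ _ _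
    _ ≤ M ^ 2 * (3 * (‖p‖ ^ 2 + ‖q‖ ^ 2 + (∫ x in edge j, ‖f x‖) ^ 2)) := by
        gcongr
        exact add_add_sq_le _ _ _
    _ ≤ M ^ 2 * (3 * (Real.pi * ‖p‖ ^ 2 + Real.pi * ‖q‖ ^ 2 + Real.pi * edgeNormSq j f)) := by
        gcongr
        · exact le_mul_of_one_le_left (sq_nonneg _) hpi
        · exact le_mul_of_one_le_left (sq_nonneg _) hpi
        · simpa [volume_real_edge, edgeNormSq] using sq_integral_norm_le hf
    _ = M ^ 2 * (3 * Real.pi) * (‖p‖ ^ 2 + ‖q‖ ^ 2 + edgeNormSq j f) := by ring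

theorem exists_L2Chain_of_edge {u : Bool → ℤ → ℝ → ℂ} {B : Bool → ℤ → ℝ} {b : Bool → ℝ}
    (hu : ∀ s j, MemLp (u s j) 2 (volume.restrict (edge j)))
    (hB : ∀ s j, edgeNormSq j (u s j) ≤ B s j) (hb : ∀ s, HasSum (B s) (b s)) :
    ∃ ψ : L2Chain, (∀ s j, ψ s =ᵐ[volume.restrict (edge j)] u s j) ∧ ‖ψ‖ ^ 2 ≤ ∑ s, b s := by
  choose g hg using fun s => exists_Lp_of_edge (hu s)
    ((hb s).summable.of_nonneg_of_le (fun j => edgeNormSq_nonneg _ _) (hB s))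
  refine ⟨WithLp.toLp 2 g, hg, ?_⟩
  rw [PiLp.norm_sq_eq_of_L2]
  exact Finset.sum_le_sum fun s _ => hasSum_le (fun j => (edgeNormSq_congr (hg s j)).trans_le
    (hB s j)) (hasSum_edgeNormSq (g s)) (hb s)

theorem IsWaveFunction.of_jacobi {A E : ℝ} {β : ℤ → ℝ} {f ψ : L2Chain} {q : ℤ → ℂ}
    {u v w : Bool → ℤ → ℝ → ℂ} (hS : sinE E Real.pi ≠ 0)
    (hsol : ∀ s j, IsEdgeSolution A E s j (f s) (u s j) (v s j) (w s j))
    (hψ : ∀ s j, ψ s =ᵐ[volume.restrict (edge j)] u s j)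
    (hleft : ∀ s j, u s j (j * Real.pi) = q j)
    (hright : ∀ s j, u s j ((j + 1) * Real.pi) = q (j + 1))
    (hq : ∀ j, disc (β j) E * q j - (2 * Real.cos (A * Real.pi) : ℝ) * (q (j + 1) + q (j - 1)) =
      source A E (fun s => f s) j) :
    IsWaveFunction A β ψ (f + (E : ℂ) • ψ) u v w where
  sobolev s j := (hsol s j).sobolev
  ae_eq := hψ
  action s j := by
    filter_upwards [(hsol s j).ae_eq, hψ s j,
      ae_restrict_of_ae (Lp.coeFn_add (f s) ((E : ℂ) • ψ s)),
      ae_restrict_of_ae (Lp.coeFn_smul (E : ℂ) (ψ s))] with x hf hx hadd hsmul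
    rw [PiLp.add_apply, PiLp.smul_apply, hadd, Pi.add_apply, hsmul, Pi.smul_apply, hx, hf, magLap,
      smul_eq_mul, sub_add_cancel]
  cont_lower j := by rw [hleft, hleft]
  cont_left s j := by
    have hj := hright s (j - 1)
    rw [sub_add_cancel, Int.cast_sub, Int.cast_one, sub_add_cancel] at hj
    rw [hj, hleft]
  delta j := by
    have hvertex := vertex_identity hsol hleft hright j
    rw [Fintype.sum_bool, ← hq j, disc] at hvertex
    refine mul_left_cancel₀ (Complex.ofReal_ne_zero.2 hS) ?_
    rw [hleft]
    push_cast at hvertex ⊢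
    linear_combination hvertex

theorem exists_isWaveFunction {E : ℝ} (hS : sinE E Real.pi ≠ 0) :
    ∃ M, 0 ≤ M ∧ ∀ (A : ℝ) (β : ℤ → ℝ) (f : L2Chain) (q : ℤ → ℂ), (Summable fun j => ‖q j‖ ^ 2) →
      (∀ j, disc (β j) E * q j - (2 * Real.cos (A * Real.pi) : ℝ) * (q (j + 1) + q (j - 1)) =
        source A E (fun s => f s) j) →
      ∃ (ψ : L2Chain) (u v w : Bool → ℤ → ℝ → ℂ),
        IsWaveFunction A β ψ (f + (E : ℂ) • ψ) u v w ∧ (∀ j : ℤ, u true j (j * Real.pi) = q j) ∧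
        ‖ψ‖ ^ 2 ≤ M * (∑' j, ‖q j‖ ^ 2 + ‖f‖ ^ 2) := by
  obtain ⟨M, hM, hedge⟩ := exists_isEdgeSolution hS
  refine ⟨4 * M, by positivity, fun A β f q hq hjacobi => ?_⟩
  choose u v w hsol hleft hright hbound using fun (s : Bool) (j : ℤ) =>
    hedge A s j (f s) (memLp_edge _ j) (q j) (q (j + 1))
  have hshift : HasSum (fun j => ‖q (j + 1)‖ ^ 2) (∑' j, ‖q j‖ ^ 2) :=
    (Equiv.addRight (1 : ℤ)).hasSum_iff.2 hq.hasSum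
  obtain ⟨ψ, hψ, hnorm⟩ := exists_L2Chain_of_edge (fun s j => (hsol s j).sobolev.memLp_edge) hbound
    fun s => ((hq.hasSum.add hshift).add (hasSum_edgeNormSq (f s))).mul_left M
  refine ⟨ψ, u, v, w, .of_jacobi hS hsol hψ hleft hright hjacobi, hleft true, hnorm.trans ?_⟩
  rw [PiLp.norm_sq_eq_of_L2, Fintype.sum_bool, Fintype.sum_bool]
  have hnonneg : 0 ≤ M * (‖f true‖ ^ 2 + ‖f false‖ ^ 2) := by positivity
  linarith

/-! ### Stability of the Fredholm property -/

theorem coFG_map {𝕜 M N : Type*} [Field 𝕜] [AddCommGroup M] [Module 𝕜 M] [AddCommGroup N]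
    [Module 𝕜 N] {f : M →ₗ[𝕜] N} {p : Submodule 𝕜 M} (hf : (LinearMap.range f).CoFG)
    (hp : p.CoFG) : (p.map f).CoFG := by
  obtain ⟨W, hW⟩ := Submodule.exists_isCompl p
  obtain ⟨X, hX⟩ := Submodule.exists_isCompl (LinearMap.range f)
  refine Submodule.FG.cofg_of_codisjoint (S := W.map f ⊔ X) ?_
    (((hp.fg_of_isCompl hW).map f).sup (hf.fg_of_isCompl hX))
  rw [codisjoint_iff, sup_right_comm, ← Submodule.map_sup, sup_comm W, hW.sup_eq_top,
    Submodule.map_top, hX.sup_eq_top]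

section Fredholm

variable {H : Type*} [NormedAddCommGroup H] [InnerProductSpace ℂ H]

theorem isClosed_range_of_coFG [CompleteSpace H] (B : H →L[ℂ] H) (h : B.range.CoFG) :
    IsClosed (B.range : Set H) := by
  have : CompleteSpace B.ker := B.isClosed_ker.completeSpace_coe
  let B' : B.kerᗮ →L[ℂ] H := B.comp B.kerᗮ.subtypeL
  have hrange : B'.range = B.range := by
    refine le_antisymm (LinearMap.range_comp_le_range _ _) ?_
    rintro _ ⟨x, rfl⟩
    obtain ⟨y, hy, z, hz, rfl⟩ := B.ker.exists_add_mem_mem_orthogonal x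
    have hBy : B y = 0 := hy
    exact ⟨⟨z, hz⟩, by simp [B', hBy]⟩
  have hker : B'.ker = ⊥ := LinearMap.ker_eq_bot'.2 fun x hx =>
    Subtype.ext (inner_self_eq_zero.1 (Submodule.inner_right_of_mem_orthogonal (K := B.ker) hx x.2))
  obtain ⟨G, hG⟩ := Submodule.exists_isCompl B'.range
  have : FiniteDimensional ℂ G := .of_fg (Submodule.CoFG.fg_of_isCompl hG (hrange ▸ h))
  rw [← hrange]
  exact B'.closed_complemented_range_of_isCompl_of_ker_eq_bot G hG G.closed_of_finiteDimensional
    hker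

variable {T T' : H →ₗ.[ℂ] H} {e z : ℂ}

theorem shift_apply (T : H →ₗ.[ℂ] H) (z : ℂ) (x : T.domain) :
    shift T z x = T x - z • (x : H) := rfl

theorem IsResolventPoint.exists_range_shift_eq (he : IsResolventPoint T e) (z : ℂ) :
    ∃ B : H →L[ℂ] H, LinearMap.range (shift T z) = B.range := by
  obtain ⟨R, hleft, hright⟩ := he
  refine ⟨ContinuousLinearMap.id ℂ H + (e - z) • R, le_antisymm ?_ ?_⟩
  · rintro _ ⟨x, rfl⟩
    refine ⟨shift T e x, ?_⟩
    simp only [ContinuousLinearMap.coe_coe, add_apply, ContinuousLinearMap.id_apply, smul_apply,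
      hleft]
    simp only [shift_apply]
    module
  · rintro _ ⟨y, rfl⟩
    obtain ⟨hRy, hy⟩ := hright y
    refine ⟨⟨R y, hRy⟩, ?_⟩
    simp only [shift_apply, ContinuousLinearMap.coe_coe, add_apply, ContinuousLinearMap.id_apply,
      smul_apply] at hy ⊢
    rw [sub_eq_iff_eq_add.1 hy]
    module

theorem IsResolventPoint.isClosed_range_shift [CompleteSpace H] (he : IsResolventPoint T e)
    (h : (LinearMap.range (shift T z)).CoFG) : IsClosed (LinearMap.range (shift T z) : Set H) := by
  obtain ⟨B, hB⟩ := he.exists_range_shift_eq z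
  rw [hB] at h ⊢
  exact isClosed_range_of_coFG B h

theorem exists_shift_eq_of_mem_graph {x : T.domain} (h : ((x : H), T x) ∈ T'.graph) (z : ℂ) :
    ∃ y : T'.domain, (y : H) = x ∧ shift T' z y = shift T z x := by
  obtain ⟨y, hyx, hTy⟩ := (LinearPMap.mem_graph_iff _).1 h
  exact ⟨y, hyx, by rw [shift_apply, shift_apply, hyx, hTy]⟩

section Agreement

variable {V : Type*} [AddCommGroup V] [Module ℂ V] [FiniteDimensional ℂ V] {Φ : H × H →ₗ[ℂ] V}

theorem coFG_range_shift_of_agree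
    (hΦ : ∀ x : T.domain, Φ (x, T x) = 0 → ((x : H), T x) ∈ T'.graph)
    (h : (LinearMap.range (shift T z)).CoFG) : (LinearMap.range (shift T' z)).CoFG := by
  let Ψ : T.domain →ₗ[ℂ] V := Φ.comp (T.domain.subtype.prod T.toFun)
  refine Submodule.CoFG.of_le ?_ (coFG_map h (Submodule.CoFG.ker Ψ))
  rintro _ ⟨x, hx, rfl⟩
  obtain ⟨y, -, hy⟩ := exists_shift_eq_of_mem_graph (hΦ x hx) z
  exact ⟨y, hy⟩

theorem fg_ker_shift_of_agree
    (hΦ : ∀ x : T.domain, Φ (x, T x) = 0 → ((x : H), T x) ∈ T'.graph)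
    (h : (LinearMap.ker (shift T' z)).FG) : (LinearMap.ker (shift T z)).FG := by
  let Ψ : T.domain →ₗ[ℂ] V := Φ.comp (T.domain.subtype.prod T.toFun)
  refine Submodule.fg_of_fg_map_of_fg_inf_ker Ψ (IsNoetherian.noetherian _) ?_
  refine Submodule.fg_of_fg_map_injective _ T.domain.injective_subtype
    ((h.map T'.domain.subtype).of_le ?_)
  rintro _ ⟨x, ⟨hxker, hxΨ⟩, rfl⟩
  obtain ⟨y, hyx, hy⟩ := exists_shift_eq_of_mem_graph (hΦ x hxΨ) z
  exact ⟨y, hy.trans hxker, hyx⟩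

theorem IsFredholmAt.of_agree [CompleteSpace H] (he : IsResolventPoint T' e)
    (hΦ : ∀ p, Φ p = 0 → (p ∈ T.graph ↔ p ∈ T'.graph)) (h : IsFredholmAt T z) :
    IsFredholmAt T' z := by
  have hcoFG : (LinearMap.range (shift T' z)).CoFG := coFG_range_shift_of_agree
    (fun x hx => (hΦ _ hx).1 (T.mem_graph x)) h.finiteDimensional_coker
  have hker : (LinearMap.ker (shift T' z)).FG := fg_ker_shift_of_agree
    (fun x hx => (hΦ _ hx).2 (T'.mem_graph x))
    (Module.Finite.iff_fg.1 h.finiteDimensional_ker)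
  exact ⟨.of_fg hker, he.isClosed_range_shift hcoFG, hcoFG⟩

end Agreement

theorem isResolventPoint_of_bound {K : ℝ} (hinj : ∀ x : T.domain, shift T z x = 0 → (x : H) = 0)
    (hsurj : ∀ y : H, ∃ x : T.domain, shift T z x = y ∧ ‖(x : H)‖ ≤ K * ‖y‖) :
    IsResolventPoint T z := by
  have hbij : Function.Bijective (shift T z) :=
    ⟨LinearMap.ker_eq_bot.1 (LinearMap.ker_eq_bot'.2 fun x hx => Subtype.ext (hinj x hx)),
      fun y => (hsurj y).imp fun x hx => hx.1⟩
  let S := LinearEquiv.ofBijective (shift T z) hbij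
  let R : H →ₗ[ℂ] H := T.domain.subtype.comp (S.symm : H →ₗ[ℂ] T.domain)
  have hR (x : T.domain) : R (shift T z x) = x := congrArg Subtype.val (S.symm_apply_apply x)
  have hbound (y : H) : ‖R y‖ ≤ K * ‖y‖ := by
    obtain ⟨x, rfl, hx⟩ := hsurj y
    rwa [hR]
  exact ⟨R.mkContinuous K hbound, hR, fun y => ⟨(S.symm y).2, S.apply_symm_apply y⟩⟩

end Fredholm

/-! ### The resolvent set of the Hamiltonian -/

theorem exists_isWaveFunction_of_mem_domain {A : ℝ} {β : ℤ → ℝ} (x : (hamiltonian A β).domain) :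
    ∃ u v w, IsWaveFunction A β x (hamiltonian A β x) u v w := by
  have hx := (hamiltonian A β).mem_graph x
  rwa [hamiltonian_graph] at hx

theorem IsWaveFunction.exists_mem_domain {A : ℝ} {β : ℤ → ℝ} {ψ η : L2Chain}
    {u v w : Bool → ℤ → ℝ → ℂ} (h : IsWaveFunction A β ψ η u v w) :
    ∃ x : (hamiltonian A β).domain, (x : L2Chain) = ψ ∧ hamiltonian A β x = η := by
  have hp : (ψ, η) ∈ (hamiltonian A β).graph := (hamiltonian_graph A β).symm ▸ ⟨u, v, w, h⟩
  exact (LinearPMap.mem_graph_iff _).1 hp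

theorem source_zero (A E : ℝ) (j : ℤ) : source A E (fun s => (0 : L2Chain) s) j = 0 := by
  have hzero {s : Bool} {κ : ℝ → ℝ} (hκ : Continuous κ) (j : ℤ) :
      edgeInt A s κ j ((0 : L2Chain) s) = 0 := (edgeFunctional A s hκ j).map_zero
  have hcont := continuous_sinE E
  refine Finset.sum_eq_zero fun s _ => ?_
  rw [hzero hcont, hzero (by fun_prop), mul_zero, add_zero]

theorem eq_zero_of_shift_hamiltonian_eq_zero {A E D : ℝ} {β : ℤ → ℝ} (hE : E < 1)
    (hD : 2 * |2 * Real.cos (A * Real.pi)| < D) (hβ : ∀ j, D ≤ disc (β j) E)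
    {x : (hamiltonian A β).domain} (hx : shift (hamiltonian A β) E x = 0) : (x : L2Chain) = 0 := by
  obtain ⟨u, v, w, h⟩ := exists_isWaveFunction_of_mem_domain x
  rw [show hamiltonian A β x = (E : ℂ) • (x : L2Chain) from sub_eq_zero.1 hx] at h
  refine h.eq_zero (sinE_pi_pos hE).ne' (congrFun (jacobi_eq_zero hD hβ ?_ fun j => ?_))
  · simp only [h.trace]
    exact summable_norm_traceMap_sq A _
  · have hjacobi := h.jacobi E j
    rwa [sub_self, source_zero] at hjacobi

theorem exists_shift_hamiltonian_eq {A E D : ℝ} {β : ℤ → ℝ} (hE : E < 1)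
    (hD : 2 * |2 * Real.cos (A * Real.pi)| < D) (hβ : ∀ j, D ≤ disc (β j) E) :
    ∃ K, ∀ f : L2Chain, ∃ x : (hamiltonian A β).domain,
      shift (hamiltonian A β) E x = f ∧ ‖(x : L2Chain)‖ ≤ K * ‖f‖ := by
  obtain ⟨M, hM, hwave⟩ := exists_isWaveFunction (sinE_pi_pos hE).ne'
  obtain ⟨K, hK, hsource⟩ := exists_source_bound E
  set k := (1 / (D - 2 * |2 * Real.cos (A * Real.pi)|)) ^ 2
  refine ⟨√(M * (k * K + 1)), fun f => ?_⟩
  obtain ⟨hsummable, hle⟩ := hsource A f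
  obtain ⟨q, hq, hqle, hjacobi⟩ := exists_jacobi_solution hD hβ hsummable
  obtain ⟨ψ, u, v, w, h, -, hψ⟩ := hwave A β f q hq hjacobi
  obtain ⟨x, rfl, hTx⟩ := h.exists_mem_domain
  refine ⟨x, by rw [shift_apply, hTx, add_sub_cancel_right], ?_⟩
  have hbound : ‖(x : L2Chain)‖ ^ 2 ≤ M * (k * K + 1) * ‖f‖ ^ 2 := calc
    ‖(x : L2Chain)‖ ^ 2 ≤ M * (∑' j, ‖q j‖ ^ 2 + ‖f‖ ^ 2) := hψ
    _ ≤ M * (k * (K * ‖f‖ ^ 2) + ‖f‖ ^ 2) := by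
        gcongr
        exact hqle.trans (by gcongr)
    _ = M * (k * K + 1) * ‖f‖ ^ 2 := by ring
  rw [← Real.sqrt_sq (norm_nonneg f), ← Real.sqrt_mul (by positivity)]
  exact Real.le_sqrt_of_sq_le hbound

theorem isResolventPoint_hamiltonian {A E D : ℝ} {β : ℤ → ℝ} (hE : E < 1)
    (hD : 2 * |2 * Real.cos (A * Real.pi)| < D) (hβ : ∀ j, D ≤ disc (β j) E) :
    IsResolventPoint (hamiltonian A β) E := by
  obtain ⟨K, hK⟩ := exists_shift_hamiltonian_eq hE hD hβ
  exact isResolventPoint_of_bound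
    (fun x hx => eq_zero_of_shift_hamiltonian_eq_zero hE hD hβ hx) hK

theorem exists_isResolventPoint_hamiltonian {A B : ℝ} {β : ℤ → ℝ} (hβ : ∀ j, B ≤ β j) :
    ∃ E : ℝ, IsResolventPoint (hamiltonian A β) E := by
  obtain ⟨E, hD, hE⟩ := ((tendsto_disc_atBot B).eventually_gt_atTop
    (2 * |2 * Real.cos (A * Real.pi)|) |>.and (eventually_lt_atBot 1)).exists
  exact ⟨E, isResolventPoint_hamiltonian hE hD fun j => disc_mono hE (hβ j)⟩

/-! ### The bottom of the spectrum -/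

theorem exists_L2Chain_on_edge {k : ℝ → ℂ} (s₀ : Bool) {j₀ : ℤ}
    (hk : MemLp k 2 (volume.restrict (edge j₀))) :
    ∃ f : L2Chain, f s₀ =ᵐ[volume.restrict (edge j₀)] k ∧
      ∀ s j, (s, j) ≠ (s₀, j₀) → f s =ᵐ[volume.restrict (edge j)] 0 := by
  let u (s : Bool) (j : ℤ) : ℝ → ℂ := if (s, j) = (s₀, j₀) then k else 0
  have hu₀ : u s₀ j₀ = k := if_pos rfl
  have hu (s : Bool) (j : ℤ) (hsj : (s, j) ≠ (s₀, j₀)) : u s j = 0 := if_neg hsj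
  have hmem (s : Bool) (j : ℤ) : MemLp (u s j) 2 (volume.restrict (edge j)) := by
    by_cases hsj : (s, j) = (s₀, j₀)
    · obtain ⟨rfl, rfl⟩ := Prod.mk.inj hsj
      rwa [hu₀]
    · rw [hu s j hsj]
      exact MemLp.zero
  obtain ⟨f, hf, -⟩ := exists_L2Chain_of_edge hmem (fun _ _ => le_rfl) fun s =>
    hasSum_single j₀ fun j hj => by
      simp [hu s j fun h => hj (Prod.mk.inj h).2, edgeNormSq]
  exact ⟨f, hu₀ ▸ hf s₀ j₀, fun s j hsj => hu s j hsj ▸ hf s j⟩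

theorem edgeInt_gauge_neg_mul (A : ℝ) (s : Bool) (κ : ℝ → ℝ) (j : ℤ) :
    edgeInt A s κ j (fun x => gauge (-coeff A s) (j * Real.pi) x * κ (x - j * Real.pi)) =
      (∫ t in 0..Real.pi, κ t ^ 2 : ℝ) := by
  have hshift : ∫ t in 0..Real.pi, κ t ^ 2 = ∫ x in edge j, κ (x - j * Real.pi) ^ 2 := by
    rw [setIntegral_edge, intervalIntegral.integral_comp_sub_right (fun t => κ t ^ 2), sub_self,
      edge_length]
  rw [hshift, ← integral_complex_ofReal, edgeInt]
  refine integral_congr_ae (.of_forall fun x => ?_)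
  push_cast
  linear_combination (κ (x - j * Real.pi) : ℂ) ^ 2 * gauge_neg_mul (coeff A s) (j * Real.pi) x

theorem exists_source_ne_zero (A : ℝ) {E : ℝ} (hE : E < 1) :
    ∃ f : L2Chain, (∀ j, j ≠ 0 → j ≠ 1 → source A E (fun s => f s) j = 0) ∧
      source A E (fun s => f s) 0 ≠ 0 := by
  have hcont : Continuous fun t => sinE E (Real.pi - t) :=
    (continuous_sinE E).comp (continuous_sub_left Real.pi)
  have hgauge := continuous_gauge (-coeff A true) ((0 : ℤ) * Real.pi)
  have hprofile : Continuous fun x => gauge (-coeff A true) ((0 : ℤ) * Real.pi) x *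
      (sinE E (Real.pi - (x - (0 : ℤ) * Real.pi)) : ℂ) :=
    hgauge.mul (Complex.continuous_ofReal.comp (hcont.comp (continuous_sub_right _)))
  obtain ⟨f, hf₀, hf⟩ := exists_L2Chain_on_edge true
    (memLp_of_continuousOn (p := 2) hprofile.continuousOn)
  have hzero {κ : ℝ → ℝ} {s : Bool} {j : ℤ} (hsj : (s, j) ≠ (true, 0)) :
      edgeInt A s κ j (f s) = 0 := by
    rw [edgeInt_congr (hf s j hsj), edgeInt]
    simp
  refine ⟨f, fun j h0 h1 => ?_, ?_⟩
  · refine Finset.sum_eq_zero fun s _ => ?_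
    rw [hzero fun h => h0 (Prod.mk.inj h).2, hzero fun h => h1 (sub_eq_zero.1 (Prod.mk.inj h).2),
      mul_zero, add_zero]
  · rw [source, Fintype.sum_bool, hzero (s := true) (j := 0 - 1) (by simp),
      hzero (s := false) (j := 0) (by simp), hzero (s := false) (j := 0 - 1) (by simp), mul_zero,
      mul_zero, add_zero, add_zero, add_zero, edgeInt_congr hf₀,
      edgeInt_gauge_neg_mul A true (fun t => sinE E (Real.pi - t))]
    refine Complex.ofReal_ne_zero.2 (intervalIntegral.intervalIntegral_pos_of_pos_on
      ((hcont.pow 2).intervalIntegrable _ _) (fun t ht => ?_) Real.pi_pos).ne'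
    exact pow_pos (sinE_pos hE (by linarith [ht.2]) (by linarith [ht.1])) 2

theorem IsBandEdge.mem_spectrum {A α b : ℝ} (hb : IsBandEdge (2 * Real.cos (A * Real.pi)) α b) :
    (b : ℂ) ∈ spectrum (hamiltonian A fun _ => α) := by
  rintro ⟨R, -, hR⟩
  obtain ⟨f, hf, hf₀⟩ := exists_source_ne_zero A hb.lt_one
  obtain ⟨hRf, hshift⟩ := hR f
  obtain ⟨u, v, w, h⟩ := exists_isWaveFunction_of_mem_domain ⟨R f, hRf⟩
  rw [shift_apply] at hshift
  refine hf₀ (eq_zero_of_jacobi_bandEdge (c := 2 * Real.cos (A * Real.pi))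
    (q := fun j => u true j (j * Real.pi)) (r := source A b fun s => f s) ?_ hf fun j => ?_)
  · simp only [h.trace]
    exact summable_norm_traceMap_sq A _
  · have hjacobi := h.jacobi b j
    rwa [hshift, hb.disc_eq] at hjacobi

theorem IsBandEdge.isLeast_spectrum {A α b : ℝ}
    (hb : IsBandEdge (2 * Real.cos (A * Real.pi)) α b) :
    IsLeast {s : ℝ | (s : ℂ) ∈ spectrum (hamiltonian A fun _ => α)} b := by
  refine ⟨hb.mem_spectrum, fun s hs => ?_⟩
  by_contra! hsb
  exact hs (isResolventPoint_hamiltonian (hsb.trans hb.lt_one) (hb.lt_disc s hsb) fun _ => le_rfl)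

theorem isEigenvalue_of_jacobi {A E : ℝ} {β q : ℤ → ℝ} (hE : E < 1) (hq₀ : ∃ j, q j ≠ 0)
    (hq : Summable fun j => q j ^ 2)
    (hjacobi : ∀ j, disc (β j) E * q j = 2 * Real.cos (A * Real.pi) * (q (j + 1) + q (j - 1))) :
    IsEigenvalue (hamiltonian A β) E := by
  obtain ⟨i, hi⟩ := hq₀
  obtain ⟨M, -, hwave⟩ := exists_isWaveFunction (sinE_pi_pos hE).ne'
  obtain ⟨ψ, u, v, w, h, hu, -⟩ := hwave A β 0 (fun j => q j) (by simpa using hq) fun j => by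
    rw [source_zero, sub_eq_zero]
    exact_mod_cast hjacobi j
  rw [zero_add] at h
  have hψ : ψ ≠ 0 := by
    rintro rfl
    have htrace := h.trace i
    rw [smul_zero, Prod.mk_zero_zero, map_zero, hu] at htrace
    exact hi (by exact_mod_cast htrace)
  obtain ⟨x, rfl, hTx⟩ := h.exists_mem_domain
  exact ⟨x, hψ, hTx⟩

/-! ### The essential spectrum -/

theorem mem_hamiltonianGraph_of_trace_eq_zero {A : ℝ} {β β' : ℤ → ℝ} {p : L2Chain × L2Chain}
    (h : ∀ j, β j ≠ β' j → traceMap A j p = 0) (hp : p ∈ hamiltonianGraph A β) :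
    p ∈ hamiltonianGraph A β' := by
  obtain ⟨u, v, w, hw⟩ := hp
  refine ⟨u, v, w, { hw with delta := fun j => (hw.delta j).trans ?_ }⟩
  by_cases hj : β j = β' j
  · rw [hj]
  · rw [hw.trace j, h j hj, mul_zero, mul_zero]

theorem isFredholmAt_hamiltonian_congr {A B : ℝ} {β β' : ℤ → ℝ} {S : Finset ℤ}
    (hS : ∀ j ∉ S, β j = β' j) (hβ' : ∀ j, B ≤ β' j) {z : ℂ}
    (h : IsFredholmAt (hamiltonian A β) z) : IsFredholmAt (hamiltonian A β') z := by
  obtain ⟨E, hE⟩ := exists_isResolventPoint_hamiltonian (A := A) hβ'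
  refine h.of_agree (Φ := LinearMap.pi fun j : S => traceMap A j) hE fun p hp => ?_
  have htrace (j : ℤ) (hj : β j ≠ β' j) : traceMap A j p = 0 :=
    congrFun hp ⟨j, not_imp_comm.1 (hS j) hj⟩
  rw [hamiltonian_graph, hamiltonian_graph]
  exact ⟨mem_hamiltonianGraph_of_trace_eq_zero htrace,
    mem_hamiltonianGraph_of_trace_eq_zero fun j hj => htrace j hj.symm⟩

theorem exists_forall_le_of_eq_off {ι : Type*} {β : ι → ℝ} {α : ℝ} {S : Finset ι}
    (hβ : ∀ j ∉ S, β j = α) : ∃ B, ∀ j, B ≤ β j := by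
  obtain ⟨B, hB⟩ := (S.finite_toSet.image β).bddBelow
  refine ⟨min B α, fun j => ?_⟩
  by_cases hj : j ∈ S
  · exact (min_le_left B α).trans (hB ⟨j, hj, rfl⟩)
  · exact (min_le_right B α).trans_eq (hβ j hj).symm

theorem essSpectrum_hamiltonian_eq (A : ℝ) {α : ℝ} {β : ℤ → ℝ} {S : Finset ℤ}
    (hβ : ∀ j ∉ S, β j = α) :
    essSpectrum (hamiltonian A β) = essSpectrum (hamiltonian A fun _ => α) := by
  obtain ⟨B, hB⟩ := exists_forall_le_of_eq_off hβ
  ext z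
  exact not_congr ⟨isFredholmAt_hamiltonian_congr hβ fun _ => le_rfl,
    isFredholmAt_hamiltonian_congr (fun j hj => (hβ j hj).symm) hB⟩

theorem perturbedCoupling_of_notMem {α : ℝ} {m : ℕ} {γ : ℤ → ℝ} {j : ℤ}
    (hj : j ∉ Finset.Icc (1 : ℤ) m) : perturbedCoupling α m γ j = α :=
  if_neg (mt Finset.mem_Icc.2 hj)

theorem sum_perturbedCoupling_sub (α : ℝ) (m : ℕ) (γ : ℤ → ℝ) :
    ∑ j ∈ Finset.Icc (1 : ℤ) m, (perturbedCoupling α m γ j - α) =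
      ∑ j ∈ Finset.Icc (1 : ℤ) m, γ j :=
  Finset.sum_congr rfl fun j hj => by
    rw [perturbedCoupling, if_pos (Finset.mem_Icc.1 hj), add_sub_cancel_left]

end

end RingChain

open RingChain in
theorem mainTheorem8_general (A α : ℝ) (β : ℤ → ℝ) (S : Finset ℤ) (hβ : ∀ j ∉ S, β j = α) :
    essSpectrum (hamiltonian A β) = essSpectrum (hamiltonian A fun _ => α) ∧
      (∑ j ∈ S, (β j - α) < 0 → ∃ b E : ℝ,
        IsLeast {s : ℝ | (s : ℂ) ∈ spectrum (hamiltonian A fun _ => α)} b ∧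
          E < b ∧ IsEigenvalue (hamiltonian A β) E) := by
  refine ⟨essSpectrum_hamiltonian_eq A hβ, fun hneg => ?_⟩
  obtain ⟨b, hb⟩ := exists_isBandEdge (2 * Real.cos (A * Real.pi)) α
  obtain ⟨E, hE, q, hq₀, hq, hjacobi⟩ := exists_bound_state hb hβ hneg
  exact ⟨b, E, hb.isLeast_spectrum, hE,
    isEigenvalue_of_jacobi (hE.trans hb.lt_one) hq₀ hq hjacobi⟩

theorem mainTheorem8 (A α : ℝ) (m : ℕ) (hm : 1 ≤ m) (γ : ℤ → ℝ) :
    RingChain.essSpectrum (RingChain.hamiltonian A (RingChain.perturbedCoupling α m γ)) =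
        RingChain.essSpectrum (RingChain.hamiltonian A (fun _ => α)) ∧
      ∀ g : ℝ, g < 0 → (∀ j : ℤ, 1 ≤ j → j ≤ m → γ j = g) →
        ∃ b E : ℝ,
          IsLeast {s : ℝ | (s : ℂ) ∈ RingChain.spectrum (RingChain.hamiltonian A (fun _ => α))} b ∧
          E < b ∧
          RingChain.IsEigenvalue
            (RingChain.hamiltonian A (RingChain.perturbedCoupling α m γ)) (E : ℂ) := by
  refine (mainTheorem8_general A α _ (Finset.Icc 1 m) fun _ =>
    RingChain.perturbedCoupling_of_notMem).imp_right fun h g hg hγ => h ?_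
  rw [RingChain.sum_perturbedCoupling_sub]
  exact Finset.sum_neg (fun j hj => (hγ j (Finset.mem_Icc.1 hj).1 (Finset.mem_Icc.1 hj).2).trans_lt
    hg) ⟨1, by simp [hm]⟩
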